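/- Let $d\in\{2,3\}$, let $\Omega\subset\mathbb R^d$ be a bounded domain, $T>0$ and $r\ge 1$ an integer. Write $\|\cdot\|$ and $\langle\cdot,\cdot\rangle$ for the norm and inner product of $L^2(\Omega)$ (scalar, vector or matrix valued) and $\|\cdot\|_m$ for the norm of $H^m(\Omega)$. Put $V=H^1_0(\Omega)^d$, $Q=L^2_0(\Omega)=\{q\in L^2(\Omega):\int_\Omega q\,dx=0\}$, $a(u,v)=\langle\nabla u,\nabla v\rangle$ and $b(v,q)=-\langle\nabla\cdot v,q\rangle$. **Continuous problem.** Let $f\in C([0,T];L^2(\Omega)^d)$, and let $(u,p)$ solve $$\partial_t u-\Delta u+\nabla p=f,\quad \nabla\cdot u=0\ \text{ in }\Omega\times(0,T],\qquad u(0)=u_0,\qquad u=0\ \text{ on }\partial\Omega\times[0,T],$$ with $u(t)\in V$ and $p(t)\in Q$ for all $t\in[0,T]$, and assume the regularity $u\in C^3([0,T];L^2)\cap C^2([0,T];H^2)\cap C^1([0,T];H^{r+1})$ and $p\in C^2([0,T];H^1)\cap C^1([0,T];H^r)$. **Space discretization.** Let $h>0$ and let $V_h\subset V$, $Q_h\subset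 Q$ be finite-dimensional subspaces such that, with constants $\beta,C_A>0$, $$\beta\le\sup_{v_h\in V_h\setminus\{0\}}\frac{b(v_h,q_h)}{\|v_h\|_1\|q_h\|}\quad\text{for all }q_h\in Q_h\setminus\{0\},$$ and such that for all $v\in V\cap H^{r+1}(\Omega)^d$ and $q\in Q\cap H^r(\Omega)$ there are $i_hv\in V_h$ and $j_hq\in Q_h$ with $$\|v-i_hv\|+h\|\nabla(v-i_hv)\|\le C_Ah^{r+1}\|v\|_{r+1},\qquad \|q-j_hq\|\le C_Ah^r\|q\|_r.$$ Let $V_h^{\rm div}=\{v_h\in V_h: b(v_h,q_h)=0\ \forall q_h\in Q_h\}$. The Stokes projection $R_h(v,q)=(R_h^{u}(v,q),R_h^{p}(v,q))=(\hat u_h,\hat p_h)\in V_h\times Q_h$ is defined by $a(\hat u_h,v_h)+b(v_h,\hat p_h)=a(v,v_h)+b(v_h,q)$ for all $v_h\in V_h$ and $b(\hat u_h,q_h)=0$ for all $q_h\in Q_h$. **Time discretization.** Let $0=t_0<t_1<\dots<t_N=T$ with $N\ge 2$, $I_n=(t_{n-1},t_n]$, $\tau_n=t_n-t_{n-1}$,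 $\bar t_n=(t_{n-1}+t_n)/2$ and $\tau=\max_n\tau_n$. Assume that, with constants $c_1,c_2>0$, $$\tau_1\le c_1\tau_2\qquad\text{and}\qquad \tau_m\le c_2\tau_{m-1},\quad m=2,\dots,N .$$ **Discrete solution.** Let $u_{0,h}\in V_h^{\rm div}$. Let $u_{\tau,h}:[0,T]\to V_h$ be continuous with $u_{\tau,h}(0)=u_{0,h}$ and let $p_{\tau,h}:(0,T]\to Q_h$ be such that both are polynomials in $t$ of degree at most $1$ on each $I_n$ and, for all $n=1,\dots,N$, $v_h\in V_h$ and $q_h\in Q_h$, $$\int_{t_{n-1}}^{t_n}\big(\langle\partial_tu_{\tau,h},v_h\rangle+a(u_{\tau,h},v_h)+b(v_h,p_{\tau,h})\big)dt=\frac{\tau_n}{2}\langle f(t_{n-1})+f(t_n),v_h\rangle,\qquad \int_{t_{n-1}}^{t_n}b(u_{\tau,h},q_h)\,dt=0 .$$ (The velocity $u_{\tau,h}$ and the midpoint values $p_{\tau,h}(\bar t_n)$ are uniquely determined; $p_{\tau,h}$ itself is not.) Let $e^u_{\tau,h}(0)=R_h^{u}(u(0),p(0))-u_{\tau,h}(0)$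 be the initial discrete velocity error. **Post-processed pressure.** For $n\ge2$ let $J_np_{\tau,h}$ be the polynomial in $t$ of degree at most $1$ with the values $p_{\tau,h}(\bar t_{n-1})$ at $\bar t_{n-1}$ and $p_{\tau,h}(\bar t_n)$ at $\bar t_n$. Let $\bar p_{\tau,h}=J_2p_{\tau,h}$ on $[t_0,t_1]$ and $\bar p_{\tau,h}=J_np_{\tau,h}$ on $I_n$ for $n\ge 2$, and denote by $\bar p^+_{\tau,h}(t_{m-1})$ its right-sided limits. **Theorem.** There is a constant $C>0$, depending only on $d,\Omega,T,r$, the data and the solution $(f,u_0,u,p)$ and the constants $\beta,C_A,c_1,c_2$ (in particular not on $h$, $V_h$, $Q_h$, the time mesh, $u_{0,h}$ or the choice of $p_{\tau,h}$), such that $$\sum_{m=1}^N\tau_m\|p(t_{m-1})-\bar p^+_{\tau,h}(t_{m-1})\|^2\le C\big(\|\nabla e^u_{\tau,h}(0)\|^2+\tau^4+h^{2r}\big),$$ $$\Big(\int_0^T\|p(t)-\bar p_{\tau,h}(t)\|^2\,dt\Big)^{1/2}\le C\big(\|\nabla e^u_{\tau,h}(0)\|+\tau^2+h^r\big).$$ 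-/

import Mathlib

open MeasureTheory TopologicalSpace Set Filter Topology
open scoped Distributions

noncomputable section

namespace NonstationaryStokes

/-- The scalar space `L²(Ω)`. -/
abbrev L2 {d : ℕ} (Ω : Opens (EuclideanSpace ℝ (Fin d))) : Type :=
  Lp ℝ 2 (volume.restrict (Ω : Set (EuclideanSpace ℝ (Fin d))))

/-- The vector-valued space `L²(Ω)^d`, with inner product `∑ i, ⟨u i, v i⟩`. -/
abbrev L2Vec {d : ℕ} (Ω : Opens (EuclideanSpace ℝ (Fin d))) : Type :=
  PiLp 2 (fun _ : Fin d => L2 Ω)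

/-- The classical partial derivative `∂_{α 0} ⋯ ∂_{α (k-1)} φ` of a function. -/
def partialD {d k : ℕ} (α : Fin k → Fin d) (φ : EuclideanSpace ℝ (Fin d) → ℝ)
    (x : EuclideanSpace ℝ (Fin d)) : ℝ :=
  iteratedFDeriv ℝ k φ x (fun i => EuclideanSpace.single (α i) 1)

theorem partialD_memLp {d k : ℕ} {Ω : Opens (EuclideanSpace ℝ (Fin d))} (α : Fin k → Fin d)
    (φ : 𝓓(Ω, ℝ)) :
    MemLp (partialD α φ) 2 (volume.restrict (Ω : Set (EuclideanSpace ℝ (Fin d)))) := by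
  have hc : Continuous (partialD α φ) := by
    have h := φ.contDiff.continuous_iteratedFDeriv (m := k) (by exact_mod_cast le_top)
    exact (ContinuousMultilinearMap.apply ℝ (fun _ : Fin k => EuclideanSpace ℝ (Fin d)) ℝ
      (fun i => EuclideanSpace.single (α i) 1)).continuous.comp h
  have hs : HasCompactSupport (partialD α φ) := by
    refine (φ.hasCompactSupport.iteratedFDeriv (𝕜 := ℝ) k).mono ?_
    intro x hx
    rw [Function.mem_support] at hx ⊢
    intro h0
    apply hx
    simp [partialD, h0]
  exact (hc.memLp_of_hasCompactSupport hs).restrict _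

/-- The derivative `∂_α φ` of a test function `φ ∈ C_c^∞(Ω)`, as an element of `L²(Ω)`. -/
def testD {d k : ℕ} {Ω : Opens (EuclideanSpace ℝ (Fin d))} (α : Fin k → Fin d)
    (φ : 𝓓(Ω, ℝ)) : L2 Ω :=
  (partialD_memLp α φ).toLp

/-- The test function `φ` itself, as an element of `L²(Ω)`. -/
def testL2 {d : ℕ} {Ω : Opens (EuclideanSpace ℝ (Fin d))} (φ : 𝓓(Ω, ℝ)) : L2 Ω :=
  testD (Fin.elim0 : Fin 0 → Fin d) φ

/-- `g` is the weak derivative `∂_α v` on `Ω`: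
`∫ v ∂_α φ = (-1)^k ∫ g φ` for all `φ ∈ C_c^∞(Ω)`, where `k` is the order of `α`. -/
def IsWeakDeriv {d k : ℕ} {Ω : Opens (EuclideanSpace ℝ (Fin d))} (α : Fin k → Fin d)
    (v g : L2 Ω) : Prop :=
  ∀ φ : 𝓓(Ω, ℝ), inner ℝ v (testD α φ) = (-1 : ℝ) ^ k * inner ℝ g (testL2 φ)

/-- Directions of the partial derivatives of order at most `m`. -/
abbrev Word (d m : ℕ) : Type := (k : Fin (m + 1)) × (Fin k → Fin d)

/-- The empty word: no derivative. -/
def Word.nil (d m : ℕ) : Word d m := ⟨⟨0, Nat.succ_pos m⟩, Fin.elim0⟩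

/-- The Sobolev space `H^m(Ω)`. An element is the family `(∂_α v)_{|α| ≤ m}` of a function
`v ∈ L²(Ω)` with all its weak derivatives of order at most `m`; the function itself is the entry at
the empty word. The norm is `(∑_{k ≤ m} ‖D^k v‖²)^{1/2}`, where `|D^k v|` is the Euclidean norm of
the tensor of all `k`-th partial derivatives. -/
def sobolev {d : ℕ} (Ω : Opens (EuclideanSpace ℝ (Fin d))) (m : ℕ) :
    Submodule ℝ (PiLp 2 (fun _ : Word d m => L2 Ω)) where
  carrier := {V | ∀ w : Word d m, IsWeakDeriv w.2 (V (Word.nil d m)) (V w)}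
  add_mem' := by
    intro a b ha hb w φ
    simp only [PiLp.add_apply, inner_add_left, ha w φ, hb w φ]
    ring
  zero_mem' := by
    intro w φ
    simp
  smul_mem' := by
    intro c a ha w φ
    simp only [PiLp.smul_apply, real_inner_smul_left, ha w φ]
    ring

/-- The Hilbert space `H^m(Ω)`. -/
abbrev H {d : ℕ} (Ω : Opens (EuclideanSpace ℝ (Fin d))) (m : ℕ) : Type := ↥(sobolev Ω m)

/-- The vector-valued space `H^m(Ω)^d`. -/
abbrev HVec {d : ℕ} (Ω : Opens (EuclideanSpace ℝ (Fin d))) (m : ℕ) : Type :=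
  PiLp 2 (fun _ : Fin d => H Ω m)

section Operations

variable {d m : ℕ} {Ω : Opens (EuclideanSpace ℝ (Fin d))}

/-- The weak derivative `∂_α v ∈ L²(Ω)` of `v ∈ H^m(Ω)`, for `α` of order `k ≤ m`. -/
def H.deriv (v : H Ω m) {k : ℕ} (hk : k ≤ m) (α : Fin k → Fin d) : L2 Ω :=
  v.1 (⟨⟨k, Nat.lt_succ_of_le hk⟩, α⟩ : Word d m)

/-- The embedding `H^m(Ω) → L²(Ω)`. -/
def H.toL2 (v : H Ω m) : L2 Ω := v.1 (Word.nil d m)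

/-- The embedding `H^m(Ω)^d → L²(Ω)^d`. -/
def HVec.toL2 (v : HVec Ω m) : L2Vec Ω := WithLp.toLp 2 (fun i => (v i).toL2)

/-- The embedding `H^m(Ω) → H^l(Ω)` for `l ≤ m`. -/
def H.lower {l : ℕ} (hl : l ≤ m) (v : H Ω m) : H Ω l :=
  ⟨WithLp.toLp 2 (fun w : Word d l =>
      v.1 (⟨⟨w.1, lt_of_lt_of_le w.1.2 (Nat.succ_le_succ hl)⟩, w.2⟩ : Word d m)),
    fun w => v.2 (⟨⟨w.1, lt_of_lt_of_le w.1.2 (Nat.succ_le_succ hl)⟩, w.2⟩ : Word d m)⟩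

/-- The embedding `H^m(Ω)^d → H^l(Ω)^d` for `l ≤ m`. -/
def HVec.lower {l : ℕ} (hl : l ≤ m) (v : HVec Ω m) : HVec Ω l :=
  WithLp.toLp 2 (fun i => (v i).lower hl)

end Operations

section Forms

variable {d : ℕ} {Ω : Opens (EuclideanSpace ℝ (Fin d))}

/-- `H^1_0(Ω)`: the closure of `C_c^∞(Ω)` in `H^1(Ω)`. -/
def H10 (Ω : Opens (EuclideanSpace ℝ (Fin d))) : Set (H Ω 1) :=
  closure {v | ∃ φ : 𝓓(Ω, ℝ), ∀ w : Word d 1, v.1 w = testD w.2 φ}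

/-- `V = H^1_0(Ω)^d`. -/
def velocitySpace (Ω : Opens (EuclideanSpace ℝ (Fin d))) : Set (HVec Ω 1) :=
  {v | ∀ i, v i ∈ H10 Ω}

/-- `Q = L²_0(Ω)`. -/
def pressureSpace (Ω : Opens (EuclideanSpace ℝ (Fin d))) : Set (L2 Ω) :=
  {q | ∫ x in (Ω : Set (EuclideanSpace ℝ (Fin d))), q x = 0}

/-- The gradient `∇v = (∂_j v_i)_{ij}` of `v ∈ H^1(Ω)^d` in `L²(Ω)^{d×d}`. -/
def grad (v : HVec Ω 1) : PiLp 2 (fun _ : Fin d × Fin d => L2 Ω) :=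
  WithLp.toLp 2 (fun ij => (v ij.1).deriv le_rfl ![ij.2])

/-- The divergence `∇ · v` of `v ∈ H^1(Ω)^d`. -/
def div (v : HVec Ω 1) : L2 Ω := ∑ i, (v i).deriv le_rfl ![i]

/-- The gradient of a scalar function in `H^1(Ω)`. -/
def gradScalar (q : H Ω 1) : L2Vec Ω :=
  WithLp.toLp 2 (fun i => q.deriv le_rfl ![i])

/-- The componentwise Laplacian of `v ∈ H^2(Ω)^d`. -/
def laplacian (v : HVec Ω 2) : L2Vec Ω :=
  WithLp.toLp 2 (fun i => ∑ j, (v i).deriv le_rfl ![j, j])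

/-- `a(u, v) = ⟨∇u, ∇v⟩`. -/
def formA (u v : HVec Ω 1) : ℝ := inner ℝ (grad u) (grad v)

/-- `b(v, q) = -⟨∇ · v, q⟩`. -/
def formB (v : HVec Ω 1) (q : L2 Ω) : ℝ := -inner ℝ (div v) q

end Forms

/-- `(u, p)` is a solution on `[0, T]` of the nonstationary Stokes system
`∂_t u - Δu + ∇p = f`, `∇ · u = 0` in `Ω × (0, T]`, `u(0) = u₀` in `Ω`, `u = 0` on `∂Ω`,
with `p` of zero mean, and it is regular up to `t = 0`:
`u ∈ C³([0,T]; L²) ∩ C²([0,T]; H²) ∩ C¹([0,T]; H^{r+1})` and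
`p ∈ C²([0,T]; H¹) ∩ C¹([0,T]; H^r)`. -/
structure IsRegularStokesSolution {d : ℕ} (Ω : Opens (EuclideanSpace ℝ (Fin d))) (T : ℝ) (r : ℕ)
    (f : ℝ → L2Vec Ω) (u₀ : L2Vec Ω) (u : ℝ → HVec Ω 2) (p : ℝ → H Ω 1) : Prop where
  momentum : ∀ t ∈ Ioc 0 T,
    derivWithin (fun s => (u s).toL2) (Icc 0 T) t - laplacian (u t) + gradScalar (p t) = f t
  incompressible : ∀ t ∈ Ioc 0 T, div ((u t).lower one_le_two) = 0
  initial : (u 0).toL2 = u₀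
  boundary : ∀ t ∈ Icc 0 T, (u t).lower one_le_two ∈ velocitySpace Ω
  mean_zero : ∀ t ∈ Icc 0 T, (p t).toL2 ∈ pressureSpace Ω
  continuous_force : ContinuousOn f (Icc 0 T)
  velocity_C3_L2 : ContDiffOn ℝ 3 (fun t => (u t).toL2) (Icc 0 T)
  velocity_C2_H2 : ContDiffOn ℝ 2 u (Icc 0 T)
  velocity_C1_Hr : ∃ U : ℝ → HVec Ω (r + 1), ContDiffOn ℝ 1 U (Icc 0 T) ∧
    ∀ t ∈ Icc 0 T, (U t).toL2 = (u t).toL2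
  pressure_C2_H1 : ContDiffOn ℝ 2 p (Icc 0 T)
  pressure_C1_Hr : ∃ P : ℝ → H Ω r, ContDiffOn ℝ 1 P (Icc 0 T) ∧
    ∀ t ∈ Icc 0 T, (P t).toL2 = (p t).toL2

/-- A conforming pair of finite-dimensional spaces `V_h ⊆ V = H^1_0(Ω)^d`,
`Q_h ⊆ Q = L²_0(Ω)`. -/
structure DiscreteSpaces {d : ℕ} (Ω : Opens (EuclideanSpace ℝ (Fin d))) where
  V : Submodule ℝ (HVec Ω 1)
  Q : Submodule ℝ (L2 Ω)
  finite_V : FiniteDimensional ℝ V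
  finite_Q : FiniteDimensional ℝ Q
  V_le : (V : Set (HVec Ω 1)) ⊆ velocitySpace Ω
  Q_le : (Q : Set (L2 Ω)) ⊆ pressureSpace Ω

section Discrete

variable {d : ℕ} {Ω : Opens (EuclideanSpace ℝ (Fin d))}

/-- The discretely divergence-free functions `V_h^div`. -/
def DiscreteSpaces.Vdiv (S : DiscreteSpaces Ω) : Set (HVec Ω 1) :=
  {v | v ∈ S.V ∧ ∀ q ∈ S.Q, formB v q = 0}

/-- The inf-sup condition with constant `β`:
`β ≤ sup_{v ∈ V_h \ {0}} b(v, q) / (‖v‖₁ ‖q‖)` for all `q ∈ Q_h \ {0}`. -/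
def DiscreteSpaces.InfSup (S : DiscreteSpaces Ω) (β : ℝ) : Prop :=
  ∀ q ∈ S.Q, q ≠ 0 →
    β ≤ ⨆ v : {v : HVec Ω 1 // v ∈ S.V ∧ v ≠ 0}, formB v.1 q / (‖v.1‖ * ‖q‖)

/-- The approximation property of order `r` for the mesh size `h`, with constant `CA`. -/
def DiscreteSpaces.Approximates (S : DiscreteSpaces Ω) (r : ℕ) (h CA : ℝ) : Prop :=
  (∀ v : HVec Ω (r + 1), v.lower (Nat.le_add_left 1 r) ∈ velocitySpace Ω →
    ∃ w ∈ S.V, ‖v.toL2 - w.toL2‖ + h * ‖grad (v.lower (Nat.le_add_left 1 r) - w)‖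
      ≤ CA * h ^ (r + 1) * ‖v‖) ∧
  (∀ q : H Ω r, q.toL2 ∈ pressureSpace Ω → ∃ s ∈ S.Q, ‖q.toL2 - s‖ ≤ CA * h ^ r * ‖q‖)

/-- `(û, p̂) ∈ V_h × Q_h` solves the discrete Stokes problem that defines the Stokes projection
of `(u, p)`. -/
def DiscreteSpaces.IsStokesProjection (S : DiscreteSpaces Ω) (u : HVec Ω 1) (p : L2 Ω)
    (w : HVec Ω 1 × L2 Ω) : Prop :=
  w.1 ∈ S.V ∧ w.2 ∈ S.Q ∧
  (∀ v ∈ S.V, formA w.1 v + formB v w.2 = formA u v + formB v p) ∧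
  (∀ q ∈ S.Q, formB w.1 q = 0)

open Classical in
/-- The Stokes projection `R_h(u, p)`. Under the inf-sup condition, the defining problem has exactly
one solution; the value `0` is only used when it has none. -/
def DiscreteSpaces.stokesProjection (S : DiscreteSpaces Ω) (u : HVec Ω 1) (p : L2 Ω) :
    HVec Ω 1 × L2 Ω :=
  if h : ∃ w, S.IsStokesProjection u p w then h.choose else 0

end Discrete

/-- A time mesh `0 = t_0 < t_1 < ⋯ < t_N = T` with `N ≥ 2` intervals `I_n = (t_{n-1}, t_n]`,
`n = 1, …, N`. Values `node n` with `n > N` carry no meaning. -/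
structure TimeMesh (T : ℝ) where
  N : ℕ
  two_le : 2 ≤ N
  node : ℕ → ℝ
  node_zero : node 0 = 0
  node_last : node N = T
  node_lt : ∀ n < N, node n < node (n + 1)

namespace TimeMesh

variable {T : ℝ} (M : TimeMesh T)

/-- `τ_n = t_n - t_{n-1}` for `1 ≤ n ≤ N`. -/
def step (n : ℕ) : ℝ := M.node n - M.node (n - 1)

/-- The midpoint of `I_n`, for `1 ≤ n ≤ N`. -/
def mid (n : ℕ) : ℝ := (M.node (n - 1) + M.node n) / 2

/-- `τ = max_{1 ≤ n ≤ N} τ_n`. -/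
def maxStep : ℝ :=
  (Finset.Icc 1 M.N).sup' (Finset.nonempty_Icc.2 (le_trans one_le_two M.two_le)) M.step

/-- The number `n` with `t ∈ I_n`, for `t ∈ (0, T]`; it is `0` for `t = 0`. -/
def index (t : ℝ) : ℕ := sInf {n : ℕ | t ≤ M.node n}

theorem node_lt_node {i j : ℕ} (hij : i < j) (hj : j ≤ M.N) : M.node i < M.node j := by
  induction j with
  | zero => omega
  | succ k ih =>
    rcases Nat.lt_succ_iff_lt_or_eq.1 hij with h | h
    · exact (ih h (by omega)).trans (M.node_lt k (by omega))
    · subst h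
      exact M.node_lt i (by omega)

theorem index_eq {n : ℕ} (hn : n ∈ Finset.Icc 1 M.N) {t : ℝ}
    (ht : t ∈ Ioc (M.node (n - 1)) (M.node n)) : M.index t = n := by
  rw [Finset.mem_Icc] at hn
  apply le_antisymm
  · exact Nat.sInf_le ht.2
  · refine le_csInf ⟨n, ht.2⟩ ?_
    intro k hk
    by_contra hkn
    have hk' : k ≤ n - 1 := by omega
    have : M.node k ≤ M.node (n - 1) := by
      rcases hk'.lt_or_eq with h | h
      · exact (M.node_lt_node h (by omega)).le
      · rw [h]
    exact absurd (lt_of_lt_of_le ht.1 (le_trans hk this)) (lt_irrefl _)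

variable {B : Type*} [AddCommGroup B] [Module ℝ B]

/-- `J_n q` for `n ≥ 2`: the linear function of time through the values of `q` at the midpoints of
`I_{n-1}` and `I_n`. -/
def interp (n : ℕ) (q : ℝ → B) (t : ℝ) : B :=
  q (M.mid (n - 1)) +
    ((t - M.mid (n - 1)) / (M.mid n - M.mid (n - 1))) • (q (M.mid n) - q (M.mid (n - 1)))

/-- The post-processed trajectory: `J_2 q` on `[t_0, t_1]` and `J_n q` on `I_n` for `n ≥ 2`. -/
def postprocessed (q : ℝ → B) (t : ℝ) : B := M.interp (max 2 (M.index t)) q t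

end TimeMesh

/-- On the set `J`, the function `w` is a polynomial of degree at most `k` with coefficients in the
subspace `S`. -/
def IsPolyOn {B : Type*} [AddCommGroup B] [Module ℝ B] (k : ℕ) (J : Set ℝ) (S : Submodule ℝ B)
    (w : ℝ → B) : Prop :=
  ∃ W : Fin (k + 1) → B, (∀ j, W j ∈ S) ∧ ∀ t ∈ J, w t = ∑ j : Fin (k + 1), t ^ (j : ℕ) • W j

/-- `(u_{τ,h}, p_{τ,h})` is a solution of the fully discrete scheme with initial value `u_{0,h}`:
`u_{τ,h}` is continuous on `[0, T]`, both functions are polynomials of degree at most one in time on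
every `I_n` with values in `V_h` and `Q_h`, and the variational equations hold on every `I_n` for
all test functions that are constant in time. The right-hand side uses the trapezoidal rule. -/
structure IsDiscreteSolution {d : ℕ} {Ω : Opens (EuclideanSpace ℝ (Fin d))} {T : ℝ}
    (M : TimeMesh T) (S : DiscreteSpaces Ω) (f : ℝ → L2Vec Ω) (u₀h : HVec Ω 1)
    (uh : ℝ → HVec Ω 1) (ph : ℝ → L2 Ω) : Prop where
  initial : uh 0 = u₀h
  continuous_velocity : ContinuousOn uh (Icc 0 T)
  velocity_poly : ∀ n ∈ Finset.Icc 1 M.N, IsPolyOn 1 (Ioc (M.node (n - 1)) (M.node n)) S.V uh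
  pressure_poly : ∀ n ∈ Finset.Icc 1 M.N, IsPolyOn 1 (Ioc (M.node (n - 1)) (M.node n)) S.Q ph
  momentum : ∀ n ∈ Finset.Icc 1 M.N, ∀ v ∈ S.V,
    ∫ t in (M.node (n - 1))..(M.node n),
        (inner ℝ (deriv uh t).toL2 v.toL2 + formA (uh t) v + formB v (ph t))
      = M.step n / 2 * (inner ℝ (f (M.node (n - 1))) v.toL2 + inner ℝ (f (M.node n)) v.toL2)
  incompressible : ∀ n ∈ Finset.Icc 1 M.N, ∀ q ∈ S.Q,
    ∫ t in (M.node (n - 1))..(M.node n), formB (uh t) q = 0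

end NonstationaryStokes

end

open NonstationaryStokes

/-! Since the discrete velocity is continuous and affine on each interval and the test functions are
constant in time, every integrand of the scheme is affine and is integrated exactly by its midpoint
value. The scheme is therefore the Crank–Nicolson method for the nodal velocities, with the pressure
entering only through its midpoint values (`IsDiscreteSolution.crankNicolson`). The velocity error
is measured against the Stokes projection at the nodes, and the pressure error against the average
of the two nodal projections. Averaging the weak momentum equation over the two nodes of a step
matches the trapezoidal force exactly. What remains as consistency error is the increment of the
projected velocity minus the trapezoidal rule for `∂_t u` (`IsDiscreteSolution.error_equation`).

This remainder is of size `τ_n (h^r + τ_n²)`. The Stokes projection is linear, so its error on a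
time increment is controlled by the Lipschitz constants of `u` in `H^{r+1}` and `p` in `H^r`.
Quasi-optimality in the gradient norm and the Poincaré inequality give order `h^r`, which suffices
without a duality argument. The trapezoidal part uses `u ∈ C³(L²)`.

Stability (`crankNicolson_stability`) comes from testing with the increment of the velocity error.
Both nodal errors are discretely divergence-free, so the pressure term vanishes, the gradient norms
telescope, and the sum of `‖E_{n+1} - E_n‖² / τ_n` is bounded. The inf-sup condition then bounds the
pressure error in a discrete `L²` norm in time, which yields order `τ² + h^r` at the midpoints.

Finally, linear extrapolation through two adjacent midpoints reproduces affine functions, and its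
weights are bounded whatever the step ratio (`TimeMesh.norm_sub_interp_le`). This gives one bound
valid at every point of an interval, including its left end, so both estimates of the theorem follow
from the same sum. The mesh ratio conditions serve only to move a midpoint error from the weight of
one interval to that of its neighbour (`TimeMesh.sum_step_mul_interp_le`). -/

namespace NonstationaryStokes

/-! ### Linearity and boundedness of the forms, and norms of `H^1`. -/

section SobolevBasics

variable {d m : ℕ} {Ω : Opens (EuclideanSpace ℝ (Fin d))}

noncomputable instance : NormedAddCommGroup (HVec Ω m) := inferInstance

noncomputable instance : NormedSpace ℝ (HVec Ω m) := inferInstance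

/-- The weak derivative as a continuous linear map on `H^m(Ω)`. -/
noncomputable def H.derivL {k : ℕ} (hk : k ≤ m) (α : Fin k → Fin d) : H Ω m →L[ℝ] L2 Ω :=
  (PiLp.proj 2 (fun _ : Word d m => L2 Ω)
    (⟨⟨k, Nat.lt_succ_of_le hk⟩, α⟩ : Word d m)).comp (sobolev Ω m).subtypeL

/-- The embedding `H^m(Ω) → L²(Ω)` as a continuous linear map. -/
noncomputable def H.toL2L : H Ω m →L[ℝ] L2 Ω :=
  (PiLp.proj 2 (fun _ : Word d m => L2 Ω) (Word.nil d m)).comp (sobolev Ω m).subtypeL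

/-- The gradient as a linear map. -/
def gradLin : HVec Ω 1 →ₗ[ℝ] PiLp 2 (fun _ : Fin d × Fin d => L2 Ω) where
  toFun := grad
  map_add' _ _ := rfl
  map_smul' _ _ := rfl

/-- The divergence as a linear map. -/
noncomputable def divLin : HVec Ω 1 →ₗ[ℝ] L2 Ω where
  toFun := div
  map_add' u v := by
    simp only [div, ← Finset.sum_add_distrib]
    rfl
  map_smul' c v := by
    simp only [div, RingHom.id_apply, Finset.smul_sum]
    rfl

theorem HVec.toL2_sub (u v : HVec Ω m) : (u - v).toL2 = u.toL2 - v.toL2 := rfl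
theorem HVec.toL2_smul (c : ℝ) (v : HVec Ω m) : (c • v).toL2 = c • v.toL2 := rfl
theorem HVec.lower_sub {l : ℕ} (hl : l ≤ m) (u v : HVec Ω m) :
    (u - v).lower hl = u.lower hl - v.lower hl := rfl
theorem H.toL2_sub (u v : H Ω m) : (u - v).toL2 = u.toL2 - v.toL2 := rfl
theorem grad_add (u v : HVec Ω 1) : grad (u + v) = grad u + grad v := rfl
theorem grad_sub (u v : HVec Ω 1) : grad (u - v) = grad u - grad v := rfl
theorem grad_smul (c : ℝ) (v : HVec Ω 1) : grad (c • v) = c • grad v := rfl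
theorem div_add (u v : HVec Ω 1) : div (u + v) = div u + div v := divLin.map_add u v
theorem div_sub (u v : HVec Ω 1) : div (u - v) = div u - div v := divLin.map_sub u v
theorem div_smul (c : ℝ) (v : HVec Ω 1) : div (c • v) = c • div v := divLin.map_smul c v

theorem formA_add_left (u v w : HVec Ω 1) : formA (u + v) w = formA u w + formA v w := by
  simp only [formA, grad_add, inner_add_left]
theorem formA_sub_left (u v w : HVec Ω 1) : formA (u - v) w = formA u w - formA v w := by
  simp only [formA, grad_sub, inner_sub_left]
theorem formA_smul_left (c : ℝ) (u w : HVec Ω 1) : formA (c • u) w = c * formA u w := by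
  simp only [formA, grad_smul, real_inner_smul_left]
theorem formA_add_right (u v w : HVec Ω 1) : formA u (v + w) = formA u v + formA u w := by
  simp only [formA, grad_add, inner_add_right]
theorem formA_sub_right (u v w : HVec Ω 1) : formA u (v - w) = formA u v - formA u w := by
  simp only [formA, grad_sub, inner_sub_right]
theorem formA_smul_right (c : ℝ) (u w : HVec Ω 1) : formA u (c • w) = c * formA u w := by
  simp only [formA, grad_smul, real_inner_smul_right]
theorem formB_add_left (u v : HVec Ω 1) (q : L2 Ω) : formB (u + v) q = formB u q + formB v q := by
  simp only [formB, div_add, inner_add_left]; ring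
theorem formB_sub_left (u v : HVec Ω 1) (q : L2 Ω) : formB (u - v) q = formB u q - formB v q := by
  simp only [formB, div_sub, inner_sub_left]; ring
theorem formB_smul_left (c : ℝ) (u : HVec Ω 1) (q : L2 Ω) : formB (c • u) q = c * formB u q := by
  simp only [formB, div_smul, real_inner_smul_left]; ring
theorem formB_add_right (u : HVec Ω 1) (q s : L2 Ω) : formB u (q + s) = formB u q + formB u s := by
  simp only [formB, inner_add_right]; ring
theorem formB_sub_right (u : HVec Ω 1) (q s : L2 Ω) : formB u (q - s) = formB u q - formB u s := by
  simp only [formB, inner_sub_right]; ring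
theorem formB_smul_right (c : ℝ) (u : HVec Ω 1) (q : L2 Ω) : formB u (c • q) = c * formB u q := by
  simp only [formB, real_inner_smul_right]; ring

theorem formA_self (v : HVec Ω 1) : formA v v = ‖grad v‖ ^ 2 := real_inner_self_eq_norm_sq _

theorem abs_formA_le (u v : HVec Ω 1) : |formA u v| ≤ ‖grad u‖ * ‖grad v‖ :=
  abs_real_inner_le_norm _ _

theorem norm_div_le (v : HVec Ω 1) : ‖div v‖ ≤ d * ‖grad v‖ := by
  calc ‖div v‖ ≤ ∑ i : Fin d, ‖(v i).deriv le_rfl ![i]‖ := norm_sum_le _ _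
    _ ≤ ∑ _i : Fin d, ‖grad v‖ :=
      Finset.sum_le_sum fun i _ => PiLp.norm_apply_le (grad v) (i, i)
    _ = d * ‖grad v‖ := by simp

theorem abs_formB_le (v : HVec Ω 1) (q : L2 Ω) : |formB v q| ≤ d * ‖grad v‖ * ‖q‖ := by
  rw [formB, abs_neg]
  exact (abs_real_inner_le_norm _ _).trans
    (mul_le_mul_of_nonneg_right (norm_div_le v) (norm_nonneg _))

theorem H.norm_sq_eq (v : H Ω 1) :
    ‖v‖ ^ 2 = ‖v.toL2‖ ^ 2 + ∑ j : Fin d, ‖v.deriv le_rfl ![j]‖ ^ 2 := by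
  have h : ‖v‖ ^ 2 = ∑ w : Word d 1, ‖v.1 w‖ ^ 2 := PiLp.norm_sq_eq_of_L2 _ _
  rw [h, Fintype.sum_sigma, Fin.sum_univ_two]
  congr 1
  · exact Fintype.sum_eq_single (Fin.elim0 : Fin 0 → Fin d)
      fun x hx => absurd (Subsingleton.elim x _) hx
  · refine Fintype.sum_equiv (Equiv.funUnique (Fin 1) (Fin d)) _ _ ?_
    intro α
    have : (![(Equiv.funUnique (Fin 1) (Fin d)) α] : Fin 1 → Fin d) = α := by
      ext i
      fin_cases i
      rfl
    rw [this]
    rfl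

theorem HVec.norm_sq_eq (v : HVec Ω 1) : ‖v‖ ^ 2 = ‖v.toL2‖ ^ 2 + ‖grad v‖ ^ 2 := by
  rw [PiLp.norm_sq_eq_of_L2, PiLp.norm_sq_eq_of_L2, PiLp.norm_sq_eq_of_L2,
    Fintype.sum_prod_type, ← Finset.sum_add_distrib]
  exact Finset.sum_congr rfl fun i _ => H.norm_sq_eq (v i)

theorem norm_grad_le (v : HVec Ω 1) : ‖grad v‖ ≤ ‖v‖ := by
  have := HVec.norm_sq_eq v
  exact abs_le_of_sq_le_sq' (by nlinarith [sq_nonneg ‖v.toL2‖]) (norm_nonneg _) |>.2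

theorem HVec.norm_toL2_le (v : HVec Ω 1) : ‖v.toL2‖ ≤ ‖v‖ := by
  have := HVec.norm_sq_eq v
  exact abs_le_of_sq_le_sq' (by nlinarith [sq_nonneg ‖grad v‖]) (norm_nonneg _) |>.2

end SobolevBasics

end NonstationaryStokes

namespace NonstationaryStokes

/-! ### Weak derivatives, integration by parts and the Poincaré inequality. -/

section TestFunctions

variable {d m : ℕ} {Ω : Opens (EuclideanSpace ℝ (Fin d))}

theorem testD_coeFn {k : ℕ} (α : Fin k → Fin d) (φ : 𝓓(Ω, ℝ)) :
    testD α φ =ᵐ[volume.restrict (Ω : Set (EuclideanSpace ℝ (Fin d)))] partialD α φ :=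
  MemLp.coeFn_toLp _

theorem testL2_coeFn (φ : 𝓓(Ω, ℝ)) :
    testL2 φ =ᵐ[volume.restrict (Ω : Set (EuclideanSpace ℝ (Fin d)))] φ :=
  MemLp.coeFn_toLp (partialD_memLp (Fin.elim0 : Fin 0 → Fin d) φ)

theorem contDiff_nat (φ : 𝓓(Ω, ℝ)) (k : ℕ) : ContDiff ℝ k φ :=
  φ.contDiff.of_le (by exact_mod_cast le_top)

theorem testD_congr {k l : ℕ} {α : Fin k → Fin d} {β : Fin l → Fin d} {φ ψ : 𝓓(Ω, ℝ)}
    (h : ∀ x, partialD α φ x = partialD β ψ x) : testD α φ = testD β ψ := by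
  have h' : partialD α φ = partialD β ψ := funext h
  simp only [testD, h']

theorem testD_add {k : ℕ} (α : Fin k → Fin d) (φ ψ : 𝓓(Ω, ℝ)) :
    testD α (φ + ψ) = testD α φ + testD α ψ := by
  rw [testD, testD, testD, ← MemLp.toLp_add]
  congr 1
  funext x
  have : (⇑(φ + ψ) : EuclideanSpace ℝ (Fin d) → ℝ) = ⇑φ + ⇑ψ := rfl
  rw [partialD, this, iteratedFDeriv_add_apply (contDiff_nat φ k).contDiffAt
    (contDiff_nat ψ k).contDiffAt]
  rfl

theorem testD_smul {k : ℕ} (α : Fin k → Fin d) (c : ℝ) (φ : 𝓓(Ω, ℝ)) :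
    testD α (c • φ) = c • testD α φ := by
  rw [testD, testD, ← MemLp.toLp_const_smul]
  congr 1
  funext x
  have : (⇑(c • φ) : EuclideanSpace ℝ (Fin d) → ℝ) = c • ⇑φ := rfl
  rw [partialD, this, iteratedFDeriv_const_smul_apply (contDiff_nat φ k).contDiffAt]
  rfl

theorem testD_zero {k : ℕ} (α : Fin k → Fin d) : testD α (0 : 𝓓(Ω, ℝ)) = 0 := by
  have := testD_smul α 0 (0 : 𝓓(Ω, ℝ))
  simpa using this

/-- The partial derivative `∂_j φ` of a test function, as a test function. -/
noncomputable def dirDeriv (j : Fin d) (φ : 𝓓(Ω, ℝ)) : 𝓓(Ω, ℝ) :=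
  TestFunction.lineDerivCLM ℝ (EuclideanSpace.single j (1 : ℝ)) φ

theorem dirDeriv_apply (j : Fin d) (φ : 𝓓(Ω, ℝ)) (x : EuclideanSpace ℝ (Fin d)) :
    dirDeriv j φ x = fderiv ℝ φ x (EuclideanSpace.single j 1) := by
  rw [dirDeriv, TestFunction.lineDerivCLM_apply_of_le le_top]
  exact ((contDiff_nat φ 1).differentiable (by simp)).differentiableAt.lineDeriv_eq_fderiv

theorem testD_one (j : Fin d) (φ : 𝓓(Ω, ℝ)) : testD ![j] φ = testL2 (dirDeriv j φ) := by
  refine testD_congr fun x => ?_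
  rw [partialD, partialD, iteratedFDeriv_one_apply, iteratedFDeriv_zero_apply, dirDeriv_apply]
  rfl

/-- Since `∂_j φ` is again a test function, a second derivative of `φ` can be treated as a first
derivative. This is what allows integrating by parts once instead of twice. -/
theorem testD_two (i j : Fin d) (φ : 𝓓(Ω, ℝ)) : testD ![i, j] φ = testD ![i] (dirDeriv j φ) := by
  refine testD_congr fun x => ?_
  have h : (⇑(dirDeriv j φ) : EuclideanSpace ℝ (Fin d) → ℝ)
      = fun y => fderiv ℝ φ y (EuclideanSpace.single j 1) := funext (dirDeriv_apply j φ)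
  have hd : DifferentiableAt ℝ (fderiv ℝ φ) x :=
    (((contDiff_nat φ 2).fderiv_right (m := 1) (by norm_num)).differentiable (by simp)) x
  rw [partialD, partialD, iteratedFDeriv_one_apply, iteratedFDeriv_two_apply, h,
    fderiv_clm_apply hd (differentiableAt_const _)]
  simp

/-- This is the fundamental lemma of the calculus of variations. Test functions vanish off `Ω`, so
integrals over `Ω` and over the whole space agree. -/
theorem eq_zero_of_inner_testL2 {g : L2 Ω} (h : ∀ φ : 𝓓(Ω, ℝ), inner ℝ g (testL2 φ) = 0) :
    g = 0 := by
  have hloc : LocallyIntegrableOn g (Ω : Set (EuclideanSpace ℝ (Fin d))) volume :=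
    locallyIntegrableOn_of_locallyIntegrable_restrict
      ((Lp.memLp g).locallyIntegrable (by norm_num))
  have := Ω.isOpen.ae_eq_zero_of_integral_contDiff_smul_eq_zero hloc (fun φ hφ hc hs => by
    have h1 := h ⟨φ, hφ, hc, hs⟩
    rw [L2.inner_def] at h1
    rw [← h1, ← setIntegral_eq_integral_of_forall_compl_eq_zero
      (s := (Ω : Set (EuclideanSpace ℝ (Fin d))))]
    · refine integral_congr_ae ?_
      filter_upwards [testL2_coeFn (⟨φ, hφ, hc, hs⟩ : 𝓓(Ω, ℝ))] with x hx
      rw [hx]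
      simp
    · intro x hx
      have : φ x = 0 := image_eq_zero_of_notMem_tsupport fun hx' => hx (hs hx')
      simp [this])
  refine Lp.ext ?_
  have h2 := (ae_restrict_iff' Ω.isOpen.measurableSet).2 this
  filter_upwards [h2, Lp.coeFn_zero ℝ 2 (volume.restrict (Ω : Set (EuclideanSpace ℝ (Fin d))))]
    with x hx h0
  rw [hx, h0]
  rfl

theorem IsWeakDeriv.unique {k : ℕ} {α : Fin k → Fin d} {v g g' : L2 Ω}
    (h : IsWeakDeriv α v g) (h' : IsWeakDeriv α v g') : g = g' := by
  rw [← sub_eq_zero]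
  refine eq_zero_of_inner_testL2 fun φ => ?_
  have := (h φ).symm.trans (h' φ)
  rw [mul_right_inj' (pow_ne_zero _ (by norm_num))] at this
  rw [inner_sub_left, this, sub_self]

/-- All other entries are weak derivatives of the first one and hence unique. This identifies the
representatives of `u` in `H^2` and in `H^{r+1}`, which are only assumed to agree in `L²`, once both
are viewed in `H^1`. -/
theorem H.ext_toL2 {v w : H Ω m} (h : v.toL2 = w.toL2) : v = w := by
  refine Subtype.ext (PiLp.ext fun a => ?_)
  have hv := v.2 a
  have hw := w.2 a
  have h' : v.1 (Word.nil d m) = w.1 (Word.nil d m) := h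
  rw [h'] at hv
  exact hv.unique hw

theorem HVec.ext_toL2 {v w : HVec Ω m} (h : v.toL2 = w.toL2) : v = w :=
  PiLp.ext fun i => H.ext_toL2 (congrArg (fun z : L2Vec Ω => z i) h)

theorem HVec.lower_toL2 {l : ℕ} (hl : l ≤ m) (v : HVec Ω m) : (v.lower hl).toL2 = v.toL2 := rfl

/-- The test functions, as elements of `H^1(Ω)`. -/
def testSubmodule (Ω : Opens (EuclideanSpace ℝ (Fin d))) : Submodule ℝ (H Ω 1) where
  carrier := {v | ∃ φ : 𝓓(Ω, ℝ), ∀ w : Word d 1, v.1 w = testD w.2 φ}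
  add_mem' := by
    rintro a b ⟨φ, hφ⟩ ⟨ψ, hψ⟩
    refine ⟨φ + ψ, fun w => ?_⟩
    rw [testD_add, ← hφ, ← hψ]
    rfl
  zero_mem' := ⟨0, fun w => by rw [testD_zero]; rfl⟩
  smul_mem' := by
    rintro c a ⟨φ, hφ⟩
    refine ⟨c • φ, fun w => ?_⟩
    rw [testD_smul, ← hφ]
    rfl

theorem velocitySpace_sub {u v : HVec Ω 1} (hu : u ∈ velocitySpace Ω) (hv : v ∈ velocitySpace Ω) :
    u - v ∈ velocitySpace Ω := fun i =>
  (testSubmodule Ω).topologicalClosure.sub_mem (hu i) (hv i)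

/-- Density argument: `H^1_0` is the closure of the test functions, so a closed property needs
checking only there. -/
theorem H10_induction {P : H Ω 1 → Prop} (hP : IsClosed {v | P v})
    (h : ∀ (v : H Ω 1) (φ : 𝓓(Ω, ℝ)), v.toL2 = testL2 φ →
      (∀ j, v.deriv le_rfl ![j] = testD ![j] φ) → P v)
    {v : H Ω 1} (hv : v ∈ H10 Ω) : P v := by
  refine closure_minimal (t := {v | P v}) ?_ hP hv
  rintro w ⟨φ, hφ⟩
  exact h w φ (hφ _) fun j => hφ ⟨1, ![j]⟩

theorem inner_deriv_eq_neg (q : H Ω 1) {v : H Ω 1} (hv : v ∈ H10 Ω) (j : Fin d) :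
    inner ℝ (q.deriv le_rfl ![j]) v.toL2 = -inner ℝ q.toL2 (v.deriv le_rfl ![j]) := by
  refine H10_induction
    (P := fun v => inner ℝ (q.deriv le_rfl ![j]) v.toL2 = -inner ℝ q.toL2 (v.deriv le_rfl ![j]))
    ?_ ?_ hv
  · refine isClosed_eq ?_ ?_
    · exact continuous_const.inner (H.toL2L (Ω := Ω) (m := 1)).continuous
    · exact (continuous_const.inner (H.derivL (Ω := Ω) le_rfl ![j]).continuous).neg
  · intro v φ h0 h1
    have := q.2 ⟨1, ![j]⟩ φ
    rw [h0, h1]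
    change inner ℝ q.toL2 (testD ![j] φ) = (-1 : ℝ) ^ 1 * inner ℝ (q.deriv le_rfl ![j]) _ at this
    rw [this]
    ring

theorem inner_deriv_deriv_eq_neg (u : H Ω 2) {v : H Ω 1} (hv : v ∈ H10 Ω) (j : Fin d) :
    inner ℝ (u.deriv le_rfl ![j, j]) v.toL2
      = -inner ℝ (u.deriv one_le_two ![j]) (v.deriv le_rfl ![j]) := by
  refine H10_induction
    (P := fun v => inner ℝ (u.deriv le_rfl ![j, j]) v.toL2
      = -inner ℝ (u.deriv one_le_two ![j]) (v.deriv le_rfl ![j])) ?_ ?_ hv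
  · refine isClosed_eq ?_ ?_
    · exact continuous_const.inner (H.toL2L (Ω := Ω) (m := 1)).continuous
    · exact (continuous_const.inner (H.derivL (Ω := Ω) le_rfl ![j]).continuous).neg
  · intro v φ h0 h1
    -- Both identities evaluate `⟨u, ∂_j ∂_j φ⟩`: once with `φ` as test function for the second
    -- derivative, once with `∂_j φ` as test function for the first.
    have e2 : inner ℝ u.toL2 (testD ![j, j] φ)
        = (-1 : ℝ) ^ 2 * inner ℝ (u.deriv le_rfl ![j, j]) (testL2 φ) := u.2 ⟨2, ![j, j]⟩ φ
    have e1 : inner ℝ u.toL2 (testD ![j] (dirDeriv j φ))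
        = (-1 : ℝ) ^ 1 * inner ℝ (u.deriv one_le_two ![j]) (testL2 (dirDeriv j φ)) :=
      u.2 ⟨1, ![j]⟩ (dirDeriv j φ)
    rw [h0, h1, testD_one]
    rw [testD_two] at e2
    linarith

theorem inner_laplacian (u : HVec Ω 2) {v : HVec Ω 1} (hv : v ∈ velocitySpace Ω) :
    inner ℝ (laplacian u) v.toL2 = -formA (u.lower one_le_two) v := by
  rw [formA, PiLp.inner_apply, PiLp.inner_apply, Fintype.sum_prod_type, ← Finset.sum_neg_distrib]
  refine Finset.sum_congr rfl fun i _ => ?_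
  rw [← Finset.sum_neg_distrib]
  change inner ℝ (∑ j, (u i).deriv le_rfl ![j, j]) (v i).toL2 = _
  rw [sum_inner]
  refine Finset.sum_congr rfl fun j _ => ?_
  exact inner_deriv_deriv_eq_neg (u i) (hv i) j

theorem inner_gradScalar (q : H Ω 1) {v : HVec Ω 1} (hv : v ∈ velocitySpace Ω) :
    inner ℝ (gradScalar q) v.toL2 = formB v q.toL2 := by
  rw [formB, PiLp.inner_apply, div, sum_inner, ← Finset.sum_neg_distrib]
  refine Finset.sum_congr rfl fun i _ => ?_
  rw [real_inner_comm q.toL2]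
  exact inner_deriv_eq_neg q (hv i) i

/-- The Poincaré inequality for test functions. -/
theorem norm_testL2_le {R : ℝ} (hR0 : 0 ≤ R)
    (hR : ∀ x ∈ (Ω : Set (EuclideanSpace ℝ (Fin d))), ‖x‖ ≤ R) (j : Fin d) (φ : 𝓓(Ω, ℝ)) :
    ‖testL2 φ‖ ≤ 2 * R * ‖testD ![j] φ‖ := by
  set e : EuclideanSpace ℝ (Fin d) := EuclideanSpace.single j 1 with he
  set D : EuclideanSpace ℝ (Fin d) → ℝ := fun x => fderiv ℝ φ x e with hD
  set g : EuclideanSpace ℝ (Fin d) → ℝ := fun x => x j * φ x with hg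
  have hφd : Differentiable ℝ φ := (contDiff_nat φ 1).differentiable (by simp)
  have hφc : Continuous φ := hφd.continuous
  have hDc : Continuous D := by
    have := (contDiff_nat φ 1).continuous_fderiv (by simp)
    exact this.clm_apply continuous_const
  have hcj : Continuous fun x : EuclideanSpace ℝ (Fin d) => x j := by fun_prop
  have hsupp : ∀ ψ : EuclideanSpace ℝ (Fin d) → ℝ, Continuous ψ →
      Integrable (fun x => ψ x * φ x) volume := fun ψ hψ =>
    (hψ.mul hφc).integrable_of_hasCompactSupport φ.hasCompactSupport.mul_left
  have hgc : Continuous g := hcj.mul hφc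
  have hgd : ∀ x, fderiv ℝ g x e = φ x + x j * D x := by
    intro x
    have h1 : HasFDerivAt (fun x : EuclideanSpace ℝ (Fin d) => x j)
        (EuclideanSpace.proj j : EuclideanSpace ℝ (Fin d) →L[ℝ] ℝ) x :=
      (EuclideanSpace.proj j : EuclideanSpace ℝ (Fin d) →L[ℝ] ℝ).hasFDerivAt
    have h2 := h1.mul (hφd x).hasFDerivAt
    have h3 : fderiv ℝ g x = x j • fderiv ℝ φ x + φ x • EuclideanSpace.proj j := h2.fderiv
    rw [h3]
    simp [hD, he]
    ring
  -- As `∂_j x_j = 1`, integrating `x_j φ ∂_j φ` by parts gives `∫ φ² = -2 ∫ x_j φ ∂_j φ`. The bound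
  -- `|x_j| ≤ R` on `Ω` and Cauchy–Schwarz then give the factor `2R`.
  have hibp : ∫ x, g x * D x = -∫ x, fderiv ℝ g x e * φ x := by
    refine integral_mul_fderiv_eq_neg_fderiv_mul_of_integrable ?_ ?_ ?_ ?_ ?_
    · simp_rw [hgd]
      exact hsupp _ (hφc.add (hcj.mul hDc))
    · refine (hsupp (fun x => x j * D x) (hcj.mul hDc)).congr (ae_of_all _ fun x => ?_)
      simp only [hg, hD]
      ring
    · exact hsupp _ hgc
    · exact fun x _ => (by fun_prop : Differentiable ℝ g) x
    · exact fun x _ => hφd x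
  have hkey : ∫ x, φ x * φ x = -2 * ∫ x, g x * D x := by
    have h1 : ∫ x, fderiv ℝ g x e * φ x = (∫ x, φ x * φ x) + ∫ x, g x * D x := by
      rw [← integral_add (hsupp _ hφc)]
      · refine integral_congr_ae (ae_of_all _ fun x => ?_)
        change fderiv ℝ g x e * φ x = φ x * φ x + x j * φ x * D x
        rw [hgd]
        ring
      · refine (hsupp (fun x => x j * D x) (hcj.mul hDc)).congr (ae_of_all _ fun x => ?_)
        simp only [hg]
        ring
    linarith
  have hvan : ∀ x ∉ (Ω : Set (EuclideanSpace ℝ (Fin d))), φ x = 0 := fun x hx =>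
    image_eq_zero_of_notMem_tsupport fun hx' => hx (φ.tsupport_subset hx')
  have hgm : MemLp g 2 (volume.restrict (Ω : Set (EuclideanSpace ℝ (Fin d)))) :=
    (hgc.memLp_of_hasCompactSupport φ.hasCompactSupport.mul_left).restrict _
  have hA : ‖testL2 φ‖ ^ 2 = ∫ x, φ x * φ x := by
    rw [← real_inner_self_eq_norm_sq, L2.inner_def,
      ← setIntegral_eq_integral_of_forall_compl_eq_zero (f := fun x => φ x * φ x)
        (s := (Ω : Set (EuclideanSpace ℝ (Fin d)))) (fun x hx => by simp [hvan x hx])]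
    refine integral_congr_ae ?_
    filter_upwards [testL2_coeFn φ] with x hx
    simp [hx, pow_two]
  have hB : inner ℝ hgm.toLp (testD ![j] φ) = ∫ x, g x * D x := by
    rw [L2.inner_def, ← setIntegral_eq_integral_of_forall_compl_eq_zero (f := fun x => g x * D x)
        (s := (Ω : Set (EuclideanSpace ℝ (Fin d)))) (fun x hx => by simp [hg, hvan x hx])]
    refine integral_congr_ae ?_
    filter_upwards [testD_coeFn ![j] φ, hgm.coeFn_toLp] with x hx hx'
    rw [hx, hx', partialD, iteratedFDeriv_one_apply]
    simp [hD, he, mul_comm]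
  have hG : ‖hgm.toLp‖ ≤ R * ‖testL2 φ‖ := by
    refine Lp.norm_le_mul_norm_of_ae_le_mul ?_
    filter_upwards [testL2_coeFn φ, hgm.coeFn_toLp, ae_restrict_mem Ω.isOpen.measurableSet]
      with x hx hx' hxΩ
    rw [hx, hx']
    simp only [hg, norm_mul]
    exact mul_le_mul_of_nonneg_right ((PiLp.norm_apply_le x j).trans (hR x hxΩ)) (norm_nonneg _)
  have hfin : ‖testL2 φ‖ ^ 2 ≤ 2 * (R * ‖testL2 φ‖ * ‖testD ![j] φ‖) := by
    rw [hA, hkey, ← hB]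
    have := (abs_le.1 (abs_real_inner_le_norm hgm.toLp (testD ![j] φ))).1
    have := mul_le_mul_of_nonneg_right hG (norm_nonneg (testD ![j] φ))
    linarith
  rcases (norm_nonneg (testL2 φ)).eq_or_lt with h0 | h0
  · rw [← h0]
    positivity
  · nlinarith

theorem H.poincare {R : ℝ} (hR0 : 0 ≤ R)
    (hR : ∀ x ∈ (Ω : Set (EuclideanSpace ℝ (Fin d))), ‖x‖ ≤ R) (j : Fin d)
    {v : H Ω 1} (hv : v ∈ H10 Ω) : ‖v.toL2‖ ≤ 2 * R * ‖v.deriv le_rfl ![j]‖ := by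
  refine H10_induction (P := fun v => ‖v.toL2‖ ≤ 2 * R * ‖v.deriv le_rfl ![j]‖) ?_ ?_ hv
  · exact isClosed_le (H.toL2L (Ω := Ω) (m := 1)).continuous.norm
      (continuous_const.mul (H.derivL (Ω := Ω) le_rfl ![j]).continuous.norm)
  · intro v φ h0 h1
    rw [h0, h1]
    exact norm_testL2_le hR0 hR j φ

/-- The Poincaré inequality on `V`. -/
theorem exists_poincare (hd : 0 < d)
    (hΩ : Bornology.IsBounded (Ω : Set (EuclideanSpace ℝ (Fin d)))) :
    ∃ K : ℝ, 0 < K ∧ ∀ v ∈ velocitySpace Ω, ‖HVec.toL2 v‖ ≤ K * ‖grad v‖ := by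
  obtain ⟨R, hR0, hR⟩ := hΩ.exists_pos_norm_le
  refine ⟨2 * R, by positivity, fun v hv => ?_⟩
  refine abs_le_of_sq_le_sq' ?_ (by positivity) |>.2
  rw [mul_pow, PiLp.norm_sq_eq_of_L2, PiLp.norm_sq_eq_of_L2, Fintype.sum_prod_type, Finset.mul_sum]
  refine Finset.sum_le_sum fun i _ => ?_
  have h1 := H.poincare hR0.le hR ⟨0, hd⟩ (hv i)
  calc ‖(v i).toL2‖ ^ 2 ≤ (2 * R * ‖(v i).deriv le_rfl ![⟨0, hd⟩]‖) ^ 2 :=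
        pow_le_pow_left₀ (norm_nonneg _) h1 2
    _ = (2 * R) ^ 2 * ‖(v i).deriv le_rfl ![⟨0, hd⟩]‖ ^ 2 := mul_pow _ _ _
    _ ≤ _ := by
      refine mul_le_mul_of_nonneg_left ?_ (by positivity)
      exact Finset.single_le_sum (f := fun j => ‖(v i).deriv le_rfl ![j]‖ ^ 2)
        (fun _ _ => by positivity) (Finset.mem_univ _)

end TestFunctions

end NonstationaryStokes

namespace NonstationaryStokes

/-! ### Existence, linearity and error of the Stokes projection. -/

section StokesProjection

variable {d : ℕ} {Ω : Opens (EuclideanSpace ℝ (Fin d))} {S : DiscreteSpaces Ω} {β : ℝ}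

/-- This is the form in which the inf-sup condition is applied: a pressure is controlled by the
functional it induces on `V_h`. -/
theorem DiscreteSpaces.InfSup.mul_norm_le (hS : S.InfSup β) {q : L2 Ω} (hq : q ∈ S.Q) {K : ℝ}
    (hK : 0 ≤ K) (h : ∀ v ∈ S.V, formB v q ≤ K * ‖v‖) : β * ‖q‖ ≤ K := by
  by_cases hq0 : q = 0
  · simpa [hq0] using hK
  have hqn : 0 < ‖q‖ := norm_pos_iff.2 hq0
  rw [← le_div_iff₀ hqn]
  -- Nonnegativity of the bound covers the case that `V_h` has no nonzero element, where the real
  -- supremum takes the default value `0`.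
  refine (hS q hq hq0).trans (Real.iSup_le (fun v => ?_) (by positivity))
  have hv : 0 < ‖v.1‖ := norm_pos_iff.2 v.2.2
  rw [div_le_div_iff₀ (by positivity) hqn]
  have := mul_le_mul_of_nonneg_right (h v.1 v.2.1) hqn.le
  linarith

theorem eq_zero_of_grad_eq_zero {K : ℝ} {v : HVec Ω 1} (hK : ‖v.toL2‖ ≤ K * ‖grad v‖)
    (h : grad v = 0) : v = 0 := by
  have h1 : ‖v.toL2‖ = 0 := le_antisymm (by simpa [h] using hK) (norm_nonneg _)
  have h2 := HVec.norm_sq_eq v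
  rw [h1, h, norm_zero] at h2
  exact norm_eq_zero.1 (by nlinarith)

/-- The bilinear form of the discrete Stokes problem. -/
noncomputable def DiscreteSpaces.stokesForm (S : DiscreteSpaces Ω) :
    (S.V × S.Q) →ₗ[ℝ] (S.V × S.Q) →ₗ[ℝ] ℝ :=
  LinearMap.mk₂ ℝ (fun x y => formA x.1.1 y.1.1 + formB y.1.1 x.2.1 + formB x.1.1 y.2.1)
    (fun x x' y => by
      simp only [Prod.fst_add, Prod.snd_add, Submodule.coe_add, formA_add_left, formB_add_left,
        formB_add_right]
      ring)
    (fun c x y => by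
      simp only [Prod.smul_fst, Prod.smul_snd, Submodule.coe_smul, formA_smul_left,
        formB_smul_left, formB_smul_right, smul_eq_mul]
      ring)
    (fun x y y' => by
      simp only [Prod.fst_add, Prod.snd_add, Submodule.coe_add, formA_add_right, formB_add_left,
        formB_add_right]
      ring)
    (fun c x y => by
      simp only [Prod.smul_fst, Prod.smul_snd, Submodule.coe_smul, formA_smul_right,
        formB_smul_left, formB_smul_right, smul_eq_mul]
      ring)

theorem DiscreteSpaces.stokesForm_apply (x y : S.V × S.Q) :
    S.stokesForm x y = formA x.1.1 y.1.1 + formB y.1.1 x.2.1 + formB x.1.1 y.2.1 := rfl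

/-- The problem is a square linear system, so uniqueness gives existence. Testing a homogeneous
solution `(w, s)` with `(w, -s)` leaves `‖∇w‖² = 0`; then `w = 0` by Poincaré and `s = 0` by the
inf-sup condition. -/
theorem DiscreteSpaces.exists_isStokesProjection (hβ : 0 < β) (hS : S.InfSup β) {K : ℝ}
    (hK : ∀ v ∈ velocitySpace Ω, ‖HVec.toL2 v‖ ≤ K * ‖grad v‖) (u : HVec Ω 1) (p : L2 Ω) :
    ∃ w, S.IsStokesProjection u p w := by
  have := S.finite_V
  have := S.finite_Q
  have hinj : Function.Injective S.stokesForm := by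
    rw [injective_iff_map_eq_zero]
    rintro ⟨w, s⟩ h
    have h0 : ∀ y, S.stokesForm (w, s) y = 0 := fun y => by rw [h]; rfl
    have h1 := h0 (w, -s)
    have h2 : formB w.1 (-s.1) = -formB w.1 s.1 := by simp [formB]
    simp only [DiscreteSpaces.stokesForm_apply, Submodule.coe_neg, h2, formA_self] at h1
    have h3 : grad w.1 = 0 := norm_eq_zero.1 (by nlinarith)
    have hw : w = 0 := Subtype.ext (eq_zero_of_grad_eq_zero (hK _ (S.V_le w.2)) h3)
    subst hw
    have hs : β * ‖s.1‖ ≤ 0 := hS.mul_norm_le s.2 le_rfl fun v hv => by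
      have := h0 (⟨v, hv⟩, 0)
      simp only [DiscreteSpaces.stokesForm_apply, formA, formB, Submodule.coe_zero, inner_zero_right,
        neg_zero, add_zero] at this
      have h4 : grad (0 : HVec Ω 1) = 0 := gradLin.map_zero
      rw [h4, inner_zero_left, zero_add] at this
      rw [formB, this, zero_mul]
    have : s = 0 := Subtype.ext (norm_eq_zero.1 (by nlinarith [norm_nonneg s.1]))
    rw [this]
    rfl
  have hsurj : Function.Surjective S.stokesForm :=
    (LinearMap.injective_iff_surjective_of_finrank_eq_finrank
      (Subspace.dual_finrank_eq (K := ℝ) (V := S.V × S.Q)).symm).1 hinj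
  let ℓ : (S.V × S.Q) →ₗ[ℝ] ℝ :=
    { toFun := fun y => formA u y.1.1 + formB y.1.1 p
      map_add' := fun y y' => by
        simp only [Prod.fst_add, Submodule.coe_add, formA_add_right, formB_add_left]
        ring
      map_smul' := fun c y => by
        simp only [Prod.smul_fst, Submodule.coe_smul, formA_smul_right, formB_smul_left,
          smul_eq_mul, RingHom.id_apply]
        ring }
  obtain ⟨x, hx⟩ := hsurj ℓ
  have h0 : ∀ y : S.V × S.Q, formA x.1.1 y.1.1 + formB y.1.1 x.2.1 + formB x.1.1 y.2.1
      = formA u y.1.1 + formB y.1.1 p := fun y => by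
    rw [← DiscreteSpaces.stokesForm_apply, hx]
    rfl
  refine ⟨(x.1.1, x.2.1), x.1.2, x.2.2, fun v hv => ?_, fun q hq => ?_⟩
  · have := h0 (⟨v, hv⟩, 0)
    simpa [formB] using this
  · have := h0 (0, ⟨q, hq⟩)
    have h4 : grad (0 : HVec Ω 1) = 0 := gradLin.map_zero
    have h5 : div (0 : HVec Ω 1) = 0 := divLin.map_zero
    simpa [formA, formB, h4, h5] using this

theorem DiscreteSpaces.isStokesProjection_stokesProjection (hβ : 0 < β) (hS : S.InfSup β) {K : ℝ}
    (hK : ∀ v ∈ velocitySpace Ω, ‖HVec.toL2 v‖ ≤ K * ‖grad v‖) (u : HVec Ω 1) (p : L2 Ω) :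
    S.IsStokesProjection u p (S.stokesProjection u p) := by
  have h := DiscreteSpaces.exists_isStokesProjection hβ hS hK u p
  rw [DiscreteSpaces.stokesProjection, dif_pos h]
  exact h.choose_spec

/-- Applied to two instants, this makes the increment of the projection the projection of the
increment, so the projection error inherits a factor equal to the step size. -/
theorem DiscreteSpaces.IsStokesProjection.sub {u u' : HVec Ω 1} {p p' : L2 Ω}
    {w w' : HVec Ω 1 × L2 Ω} (h : S.IsStokesProjection u p w)
    (h' : S.IsStokesProjection u' p' w') :
    S.IsStokesProjection (u - u') (p - p') (w - w') := by
  refine ⟨S.V.sub_mem h.1 h'.1, S.Q.sub_mem h.2.1 h'.2.1, fun v hv => ?_, fun q hq => ?_⟩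
  · have := h.2.2.1 v hv
    have := h'.2.2.1 v hv
    simp only [Prod.fst_sub, Prod.snd_sub, formA_sub_left, formB_sub_right]
    linarith
  · simp only [Prod.fst_sub, formB_sub_left, h.2.2.2 q hq, h'.2.2.2 q hq, sub_zero]

/-- Quasi-optimality of the Stokes projection. -/
theorem DiscreteSpaces.IsStokesProjection.error_le (hβ : 0 < β) (hS : S.InfSup β)
    {u : HVec Ω 1} {p : L2 Ω} {w : HVec Ω 1 × L2 Ω} (h : S.IsStokesProjection u p w)
    (hdiv : div u = 0) {v : HVec Ω 1} (hv : v ∈ S.V) {q : L2 Ω} (hq : q ∈ S.Q) {δ : ℝ}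
    (hδ : ‖grad (u - v)‖ + d * ‖p - q‖ ≤ δ) :
    ‖grad (u - w.1)‖ ≤ (3 + 2 * d / β) * δ ∧
      ‖w.2 - q‖ ≤ (3 + 2 * d / β) / β * δ := by
  set G := ‖grad (u - v)‖ with hG
  set D := ‖p - q‖ with hD
  set φ := w.1 - v with hφ
  set π := w.2 - q with hπ
  set x := ‖grad φ‖ with hx
  have hd0 : (0 : ℝ) ≤ d := Nat.cast_nonneg d
  have hG0 : 0 ≤ G := norm_nonneg _
  have hD0 : 0 ≤ D := norm_nonneg _
  have hx0 : 0 ≤ x := norm_nonneg _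
  have hdD : 0 ≤ d * D := by positivity
  have hδ0 : 0 ≤ δ := by linarith
  have hGδ : G ≤ δ := by linarith
  have hφV : φ ∈ S.V := S.V.sub_mem h.1 hv
  have hπQ : π ∈ S.Q := S.Q.sub_mem h.2.1 hq
  have heq : ∀ z ∈ S.V, formA φ z + formB z π = formA (u - v) z + formB z (p - q) := by
    intro z hz
    have := h.2.2.1 z hz
    simp only [hφ, hπ, formA_sub_left, formB_sub_right]
    linarith
  have hrhs : ∀ z : HVec Ω 1, |formA (u - v) z + formB z (p - q)| ≤ δ * ‖grad z‖ := by
    intro z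
    calc |formA (u - v) z + formB z (p - q)| ≤ |formA (u - v) z| + |formB z (p - q)| :=
          abs_add_le _ _
      _ ≤ G * ‖grad z‖ + d * ‖grad z‖ * D := add_le_add (abs_formA_le _ _) (abs_formB_le _ _)
      _ = (G + d * D) * ‖grad z‖ := by ring
      _ ≤ δ * ‖grad z‖ := mul_le_mul_of_nonneg_right hδ (norm_nonneg _)
  -- The inf-sup condition bounds the pressure part by the velocity part.
  have hπle : β * ‖π‖ ≤ x + δ := by
    refine hS.mul_norm_le hπQ (by positivity) fun z hz => ?_
    have h1 := heq z hz
    have h2 := (abs_le.1 (hrhs z)).2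
    have h3 := (abs_le.1 (abs_formA_le φ z)).1
    have h4 : (x + δ) * ‖grad z‖ ≤ (x + δ) * ‖z‖ :=
      mul_le_mul_of_nonneg_left (norm_grad_le z) (by positivity)
    linarith
  -- Although `v` need not be discretely divergence-free, both `u` and `w.1` are annihilated by
  -- `b(·, π)`, so `b(φ, π)` equals `b(u - v, π)` and is small.
  have hφπ : -(d * δ * ‖π‖) ≤ formB φ π := by
    have h1 : formB u π = 0 := by simp [formB, hdiv]
    have h2 : formB φ π = formB (u - v) π := by
      rw [hφ, formB_sub_left, formB_sub_left, h.2.2.2 π hπQ, h1]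
    rw [h2]
    have h3 := (abs_le.1 (abs_formB_le (u - v) π)).1
    have h4 : d * G * ‖π‖ ≤ d * δ * ‖π‖ := by gcongr
    linarith
  have hquad : x ^ 2 ≤ δ * x + d * δ * ((x + δ) / β) := by
    have h1 := heq φ hφV
    rw [formA_self] at h1
    have h2 := (abs_le.1 (hrhs φ)).2
    have h3 : ‖π‖ ≤ (x + δ) / β := by
      rw [le_div_iff₀ hβ]
      linarith
    have h4 : d * δ * ‖π‖ ≤ d * δ * ((x + δ) / β) := by gcongr
    linarith
  have hc : 0 ≤ (d : ℝ) / β := by positivity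
  -- Were `x` larger, then `δ ≤ x`, and the quadratic inequality would give `x² ≤ (1 + 2d/β) δ x`, a
  -- contradiction.
  have hxle : x ≤ (2 + 2 * d / β) * δ := by
    by_contra hlt
    push Not at hlt
    have e1 : (d : ℝ) * δ * ((x + δ) / β) = d / β * δ * (x + δ) := by ring
    have e2 : (2 + 2 * d / β) * δ = 2 * (1 + d / β) * δ := by ring
    rw [e1] at hquad
    rw [e2] at hlt
    set c := (d : ℝ) / β
    have hcδ : 0 ≤ c * δ := by positivity
    have hxpos : 0 < x := lt_of_le_of_lt (by positivity) hlt
    have hxδ : δ ≤ x := by nlinarith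
    nlinarith
  constructor
  · have h1 : grad (u - w.1) = grad (u - v) - grad φ := by
      simp only [hφ, grad_sub]
      abel
    rw [h1]
    refine (norm_sub_le _ _).trans ?_
    have : (3 + 2 * d / β) * δ = δ + (2 + 2 * d / β) * δ := by ring
    linarith
  · rw [div_mul_eq_mul_div, le_div_iff₀ hβ]
    have : (3 + 2 * d / β) * δ = δ + (2 + 2 * d / β) * δ := by ring
    linarith

/-- The error of the Stokes projection under the approximation property of order `r`. -/
theorem DiscreteSpaces.exists_stokesProjection_error (d : ℕ)
    (Ω : Opens (EuclideanSpace ℝ (Fin d))) (r : ℕ) {β CA : ℝ} (hβ : 0 < β) (hCA : 0 < CA) :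
    ∃ K : ℝ, 0 < K ∧ ∀ (S : DiscreteSpaces Ω) (h : ℝ), 0 < h → S.InfSup β →
      S.Approximates r h CA → ∀ (v : HVec Ω (r + 1)) (q : H Ω r) (w : HVec Ω 1 × L2 Ω),
      v.lower (Nat.le_add_left 1 r) ∈ velocitySpace Ω → q.toL2 ∈ pressureSpace Ω →
      div (v.lower (Nat.le_add_left 1 r)) = 0 →
      S.IsStokesProjection (v.lower (Nat.le_add_left 1 r)) q.toL2 w →
      ‖grad (v.lower (Nat.le_add_left 1 r) - w.1)‖ ≤ K * h ^ r * (‖v‖ + ‖q‖) ∧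
        ‖q.toL2 - w.2‖ ≤ K * h ^ r * (‖v‖ + ‖q‖) := by
  set c := 3 + 2 * (d : ℝ) / β with hc
  have hc0 : 0 < c := by positivity
  refine ⟨c * ((1 + d) * CA) + CA + c / β * ((1 + d) * CA), by positivity, ?_⟩
  intro S h hh hS happ v q w hv hq hdiv hw
  obtain ⟨z, hz, hze⟩ := happ.1 v hv
  obtain ⟨s, hs, hse⟩ := happ.2 q hq
  have hhr : 0 < h ^ r := by positivity
  have hG : ‖grad (v.lower (Nat.le_add_left 1 r) - z)‖ ≤ CA * h ^ r * ‖v‖ := by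
    refine le_of_mul_le_mul_left ?_ hh
    have := norm_nonneg (v.toL2 - z.toL2)
    calc _ ≤ CA * h ^ (r + 1) * ‖v‖ := by linarith
      _ = _ := by ring
  have hn : 0 ≤ ‖v‖ + ‖q‖ := by positivity
  have hδ : ‖grad (v.lower (Nat.le_add_left 1 r) - z)‖ + d * ‖q.toL2 - s‖
      ≤ (1 + d) * CA * (h ^ r * (‖v‖ + ‖q‖)) := by
    have h1 : (d : ℝ) * ‖q.toL2 - s‖ ≤ d * (CA * h ^ r * ‖q‖) := by gcongr
    have h2 : 0 ≤ CA * h ^ r * ‖q‖ := by positivity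
    have h3 : 0 ≤ d * (CA * h ^ r * ‖v‖) := by positivity
    nlinarith
  obtain ⟨h1, h2⟩ := hw.error_le hβ hS hdiv hz hs hδ
  have hX : 0 ≤ h ^ r * (‖v‖ + ‖q‖) := by positivity
  set X := h ^ r * (‖v‖ + ‖q‖) with hXdef
  have e1 : 0 ≤ CA * X := by positivity
  have e2 : 0 ≤ c / β * ((1 + d) * CA) * X := by positivity
  have e3 : 0 ≤ c * ((1 + d) * CA) * X := by positivity
  rw [mul_assoc, ← hXdef]
  constructor
  · nlinarith
  · have h3 : ‖q.toL2 - s‖ ≤ CA * X := by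
      refine hse.trans ?_
      rw [hXdef, mul_assoc]
      gcongr
      exact le_add_of_nonneg_left (norm_nonneg _)
    have h4 : q.toL2 - w.2 = (q.toL2 - s) - (w.2 - s) := by abel
    rw [h4]
    refine (norm_sub_le _ _).trans ?_
    nlinarith

end StokesProjection

end NonstationaryStokes

namespace NonstationaryStokes

/-! ### Taylor, trapezoidal, midpoint and extrapolation estimates in time. -/

section TimeEstimates

variable {E : Type*} [NormedAddCommGroup E] {T : ℝ} {g : ℝ → E}

theorem exists_norm_bound (hg : ContinuousOn g (Icc 0 T)) :
    ∃ K : ℝ, 0 < K ∧ ∀ t ∈ Icc 0 T, ‖g t‖ ≤ K := by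
  obtain ⟨K, hK⟩ := isCompact_Icc.exists_bound_of_continuousOn hg
  exact ⟨|K| + 1, by positivity, fun t ht => by linarith [hK t ht, le_abs_self K]⟩

variable [NormedSpace ℝ E]

/-- Subtracting the tangent at `s` leaves a function with derivative `g'(x) - g'(s)`, which is
Lipschitz-small between `s` and `t`; the mean value inequality gives the second factor. The point
`t` may lie on either side of `s`, as midpoints and extrapolation require. -/
theorem exists_taylor_bound (hT : 0 < T) (hg : ContDiffOn ℝ 2 g (Icc 0 T)) :
    ∃ K : ℝ, 0 < K ∧ ∀ s ∈ Icc 0 T, ∀ t ∈ Icc 0 T,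
      ‖g t - g s - (t - s) • derivWithin g (Icc 0 T) s‖ ≤ K * (t - s) ^ 2 := by
  have hud : UniqueDiffOn ℝ (Icc (0 : ℝ) T) := uniqueDiffOn_Icc hT
  have hg' : ContDiffOn ℝ 1 (derivWithin g (Icc 0 T)) (Icc 0 T) :=
    hg.derivWithin hud (by norm_num)
  obtain ⟨K, hK⟩ := hg'.exists_lipschitzOnWith (by simp) (convex_Icc 0 T) isCompact_Icc
  refine ⟨K + 1, by positivity, fun s hs t ht => ?_⟩
  set G := derivWithin g (Icc 0 T) s with hG
  have hsub : uIcc s t ⊆ Icc 0 T := (convex_Icc (0 : ℝ) T).ordConnected.uIcc_subset hs ht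
  have hder : ∀ x ∈ uIcc s t, HasDerivWithinAt (fun x => g x - (x - s) • G)
      (derivWithin g (Icc 0 T) x - G) (uIcc s t) x := by
    intro x hx
    have h1 := ((hg.differentiableOn (by simp)) x (hsub hx)).hasDerivWithinAt.mono hsub
    have h2 := (((hasDerivWithinAt_id x (uIcc s t)).sub_const s).smul_const G)
    have h3 := h1.sub h2
    rw [one_smul] at h3
    exact h3
  have hb : ∀ x ∈ uIcc s t, ‖derivWithin g (Icc 0 T) x - G‖ ≤ K * |t - s| := by
    intro x hx
    have h1 := hK.dist_le_mul x (hsub hx) s hs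
    rw [dist_eq_norm, Real.dist_eq] at h1
    exact h1.trans (mul_le_mul_of_nonneg_left (abs_sub_left_of_mem_uIcc hx) K.2)
  have := (convex_uIcc s t).norm_image_sub_le_of_norm_hasDerivWithin_le hder hb left_mem_uIcc
    right_mem_uIcc
  have e : g t - (t - s) • G - (g s - (s - s) • G) = g t - g s - (t - s) • G := by
    rw [sub_self, zero_smul]
    abel
  rw [e, Real.norm_eq_abs, mul_assoc, abs_mul_abs_self] at this
  nlinarith [sq_nonneg (t - s)]

/-- The error of the trapezoidal rule. -/
theorem exists_trapezoid_bound (hT : 0 < T) (hg : ContDiffOn ℝ 3 g (Icc 0 T)) :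
    ∃ K : ℝ, 0 < K ∧ ∀ s ∈ Icc 0 T, ∀ t ∈ Icc 0 T, s ≤ t →
      ‖g t - g s - ((t - s) / 2) • (derivWithin g (Icc 0 T) s + derivWithin g (Icc 0 T) t)‖
        ≤ K * (t - s) ^ 3 := by
  have hud : UniqueDiffOn ℝ (Icc (0 : ℝ) T) := uniqueDiffOn_Icc hT
  set g' := derivWithin g (Icc 0 T) with hg'def
  have hg' : ContDiffOn ℝ 2 g' (Icc 0 T) := hg.derivWithin hud (by norm_num)
  obtain ⟨K, hK0, hK⟩ := exists_taylor_bound hT hg'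
  refine ⟨K, hK0, fun s hs t ht hst => ?_⟩
  have hsub : Icc s t ⊆ Icc 0 T := Icc_subset_Icc hs.1 ht.2
  have hder : ∀ x ∈ Icc s t, HasDerivWithinAt (fun x => g x - ((x - s) / 2) • (g' s + g' x))
      (g' x - (((x - s) / 2) • derivWithin g' (Icc 0 T) x + (1 / 2 : ℝ) • (g' s + g' x)))
      (Icc s t) x := by
    intro x hx
    have h1 := ((hg.differentiableOn (by simp)) x (hsub hx)).hasDerivWithinAt.mono hsub
    have h2 := ((hg'.differentiableOn (by simp)) x (hsub hx)).hasDerivWithinAt.mono hsub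
    have h3 := ((hasDerivWithinAt_id x (Icc s t)).sub_const s).div_const 2
    exact h1.sub (h3.smul (h2.const_add (g' s)))
  have hb : ∀ x ∈ Icc s t, ‖g' x - (((x - s) / 2) • derivWithin g' (Icc 0 T) x
      + (1 / 2 : ℝ) • (g' s + g' x))‖ ≤ K * (t - s) ^ 2 := by
    intro x hx
    have h1 := hK x (hsub hx) s hs
    -- As a function of its right end point, the quadrature error has as derivative minus half the
    -- Taylor remainder of `g'` expanded at `x` and evaluated at `s`.
    have e : g' x - (((x - s) / 2) • derivWithin g' (Icc 0 T) x + (1 / 2 : ℝ) • (g' s + g' x))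
        = (-(1 / 2) : ℝ) • (g' s - g' x - (s - x) • derivWithin g' (Icc 0 T) x) := by
      module
    rw [e, norm_smul]
    have h2 : (s - x) ^ 2 ≤ (t - s) ^ 2 := by
      nlinarith [hx.1, hx.2]
    have h3 : K * (s - x) ^ 2 ≤ K * (t - s) ^ 2 := by gcongr
    have h4 : ‖(-(1 / 2) : ℝ)‖ = 1 / 2 := by norm_num
    rw [h4]
    have := norm_nonneg (g' s - g' x - (s - x) • derivWithin g' (Icc 0 T) x)
    linarith
  have := (convex_Icc s t).norm_image_sub_le_of_norm_hasDerivWithin_le hder hb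
    (left_mem_Icc.2 hst) (right_mem_Icc.2 hst)
  have e : g t - ((t - s) / 2) • (g' s + g' t) - (g s - ((s - s) / 2) • (g' s + g' s))
      = g t - g s - ((t - s) / 2) • (g' s + g' t) := by
    rw [sub_self, zero_div, zero_smul]
    abel
  rw [e, Real.norm_of_nonneg (by linarith)] at this
  refine this.trans (le_of_eq ?_)
  ring

theorem exists_lipschitz_bound (hg : ContDiffOn ℝ 1 g (Icc 0 T)) :
    ∃ K : ℝ, 0 < K ∧ ∀ s ∈ Icc 0 T, ∀ t ∈ Icc 0 T, ‖g t - g s‖ ≤ K * |t - s| := by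
  obtain ⟨K, hK⟩ := hg.exists_lipschitzOnWith (by simp) (convex_Icc 0 T) isCompact_Icc
  refine ⟨K + 1, by positivity, fun s hs t ht => ?_⟩
  have := hK.dist_le_mul t ht s hs
  rw [dist_eq_norm, Real.dist_eq] at this
  nlinarith [abs_nonneg (t - s)]

theorem norm_midpoint_sub_le {K : ℝ} {G : E} {a b : ℝ}
    (h : ∀ t ∈ ({a, b} : Set ℝ), ‖g t - g ((a + b) / 2) - (t - (a + b) / 2) • G‖
      ≤ K * (t - (a + b) / 2) ^ 2) :
    ‖g ((a + b) / 2) - (1 / 2 : ℝ) • (g a + g b)‖ ≤ K * (b - a) ^ 2 / 4 := by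
  have h1 := h a (by simp)
  have h2 := h b (by simp)
  set m := (a + b) / 2 with hm
  -- The first-order terms cancel because `a` and `b` lie symmetrically about `m`.
  have e : g m - (1 / 2 : ℝ) • (g a + g b)
      = (-(1 / 2) : ℝ) • ((g a - g m - (a - m) • G) + (g b - g m - (b - m) • G)) := by
    rw [hm]
    module
  rw [e, norm_smul]
  have h4 : ‖(-(1 / 2) : ℝ)‖ = 1 / 2 := by norm_num
  have h5 := norm_add_le (g a - g m - (a - m) • G) (g b - g m - (b - m) • G)
  have e1 : (a - m) ^ 2 = (b - a) ^ 2 / 4 := by rw [hm]; ring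
  have e2 : (b - m) ^ 2 = (b - a) ^ 2 / 4 := by rw [hm]; ring
  rw [e1] at h1
  rw [e2] at h2
  rw [h4]
  linarith

/-- Linear extrapolation of perturbed values at two points. -/
theorem norm_sub_linear_le {K δ : ℝ} (hK : 0 ≤ K) {G : E} {a b t : ℝ} {A B : E} (hab : a < b)
    (hs : |(t - a) / (b - a)| ≤ 2) (ha : |a - t| ≤ δ) (hb : |b - t| ≤ δ)
    (hga : ‖g a - g t - (a - t) • G‖ ≤ K * (a - t) ^ 2)
    (hgb : ‖g b - g t - (b - t) • G‖ ≤ K * (b - t) ^ 2) :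
    ‖g t - (A + ((t - a) / (b - a)) • (B - A))‖
      ≤ 5 * K * δ ^ 2 + 3 * ‖g a - A‖ + 2 * ‖g b - B‖ := by
  set s := (t - a) / (b - a) with hsdef
  have hsab : s * (b - a) = t - a := div_mul_cancel₀ _ (by linarith)
  set x := g a - g t - (a - t) • G with hx
  set y := g b - g t - (b - t) • G with hy
  -- The weights `1 - s` and `s` reproduce affine functions, so the slope `G` drops out and only the
  -- value errors and the two Taylor remainders survive. The factors `3` and `2` bound the weights,
  -- and `5` is their sum.
  have e : g t - (A + s • (B - A))
      = (1 - s) • (g a - A) + s • (g b - B) - ((1 - s) • x + s • y) := by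
    have e1 : (1 - s) • x + s • y
        = (1 - s) • g a + s • g b - g t - (a - t + s * (b - a)) • G := by
      rw [hx, hy]
      module
    rw [e1, hsab]
    module
  have h1s : |1 - s| ≤ 3 := by
    have := abs_le.1 hs
    rw [abs_le]
    constructor <;> linarith
  have hxb : ‖x‖ ≤ K * δ ^ 2 := hga.trans
    (mul_le_mul_of_nonneg_left (sq_le_sq' (by linarith [abs_le.1 ha]) (abs_le.1 ha).2) hK)
  have hyb : ‖y‖ ≤ K * δ ^ 2 := hgb.trans
    (mul_le_mul_of_nonneg_left (sq_le_sq' (by linarith [abs_le.1 hb]) (abs_le.1 hb).2) hK)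
  have n1 : ∀ z : E, ‖(1 - s) • z‖ ≤ 3 * ‖z‖ := fun z => by
    rw [norm_smul]
    exact mul_le_mul_of_nonneg_right h1s (norm_nonneg _)
  have n2 : ∀ z : E, ‖s • z‖ ≤ 2 * ‖z‖ := fun z => by
    rw [norm_smul]
    exact mul_le_mul_of_nonneg_right hs (norm_nonneg _)
  rw [e]
  have t1 := norm_sub_le ((1 - s) • (g a - A) + s • (g b - B)) ((1 - s) • x + s • y)
  have t2 := norm_add_le ((1 - s) • (g a - A)) (s • (g b - B))
  have t3 := norm_add_le ((1 - s) • x) (s • y)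
  have := n1 (g a - A)
  have := n2 (g b - B)
  have := n1 x
  have := n2 y
  linarith

theorem integral_affine (A B a b : ℝ) :
    ∫ t in a..b, (A + t * B) = (b - a) * (A + (a + b) / 2 * B) := by
  rw [intervalIntegral.integral_add (by simp) (by
    exact (continuous_id.mul continuous_const).intervalIntegrable _ _)]
  rw [intervalIntegral.integral_const, intervalIntegral.integral_mul_const, integral_id]
  simp only [smul_eq_mul]
  ring

end TimeEstimates

/-! ### The exact solution up to the initial time. -/

section ExactSolution

variable {d : ℕ} {Ω : Opens (EuclideanSpace ℝ (Fin d))} {T : ℝ} {r : ℕ}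
  {f : ℝ → L2Vec Ω} {u₀ : L2Vec Ω} {u : ℝ → HVec Ω 2} {p : ℝ → H Ω 1}

theorem continuous_formA_lower (v : HVec Ω 1) :
    Continuous fun w : HVec Ω 2 => formA (w.lower one_le_two) v := by
  simp only [formA, PiLp.inner_apply]
  refine continuous_finsetSum _ fun ij _ => Continuous.inner ?_ continuous_const
  exact (H.derivL (Ω := Ω) one_le_two ![ij.2]).continuous.comp
    (PiLp.continuous_apply 2 (fun _ : Fin d => H Ω 2) ij.1)

theorem continuous_div_lower : Continuous fun w : HVec Ω 2 => div (w.lower one_le_two) := by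
  simp only [div]
  refine continuous_finsetSum _ fun i _ => ?_
  exact (H.derivL (Ω := Ω) one_le_two ![i]).continuous.comp
    (PiLp.continuous_apply 2 (fun _ : Fin d => H Ω 2) i)

theorem Icc_subset_closure_Ioc (hT : 0 < T) : Icc 0 T ⊆ closure (Ioc 0 T) := by
  rw [closure_Ioc hT.ne]

/-- The equation is assumed only for `t > 0` and extends to `t = 0` by continuity. The initial time
is needed because it is a node of the mesh. -/
theorem IsRegularStokesSolution.div_eq_zero (hsol : IsRegularStokesSolution Ω T r f u₀ u p)
    (hT : 0 < T) {t : ℝ} (ht : t ∈ Icc 0 T) : div ((u t).lower one_le_two) = 0 := by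
  have h : EqOn (fun t => div ((u t).lower one_le_two)) (fun _ => (0 : L2 Ω)) (Ioc 0 T) :=
    fun t ht => hsol.incompressible t ht
  exact h.of_subset_closure
    (continuous_div_lower.comp_continuousOn hsol.velocity_C2_H2.continuousOn)
    continuousOn_const Ioc_subset_Icc_self (Icc_subset_closure_Ioc hT) ht

/-- The weak form of the momentum equation, up to the initial time. -/
theorem IsRegularStokesSolution.weak_momentum (hsol : IsRegularStokesSolution Ω T r f u₀ u p)
    (hT : 0 < T) {v : HVec Ω 1} (hv : v ∈ velocitySpace Ω) {t : ℝ} (ht : t ∈ Icc 0 T) :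
    inner ℝ (derivWithin (fun s => (u s).toL2) (Icc 0 T) t) v.toL2
      + formA ((u t).lower one_le_two) v + formB v (p t).toL2 = inner ℝ (f t) v.toL2 := by
  have h : EqOn (fun t => inner ℝ (derivWithin (fun s => (u s).toL2) (Icc 0 T) t) v.toL2
      + formA ((u t).lower one_le_two) v + formB v (p t).toL2)
      (fun t => inner ℝ (f t) v.toL2) (Ioc 0 T) := by
    intro t ht
    have := hsol.momentum t ht
    simp only
    rw [← this, inner_add_left, inner_sub_left, inner_laplacian _ hv, inner_gradScalar _ hv]
    ring
  -- Both sides are continuous on `[0, T]`, so the identity extends to `t = 0`, where the first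
  -- trapezoidal rule evaluates `f`.
  refine h.of_subset_closure ?_ ?_ Ioc_subset_Icc_self (Icc_subset_closure_Ioc hT) ht
  · refine (ContinuousOn.add ?_ ?_).add ?_
    · exact (hsol.velocity_C3_L2.continuousOn_derivWithin (uniqueDiffOn_Icc hT)
        (by norm_num)).inner continuousOn_const
    · exact (continuous_formA_lower v).comp_continuousOn hsol.velocity_C2_H2.continuousOn
    · exact (continuousOn_const.inner ((H.toL2L (Ω := Ω) (m := 1)).continuous.comp_continuousOn
        hsol.pressure_C2_H1.continuousOn)).neg
  · exact hsol.continuous_force.inner continuousOn_const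

theorem IsRegularStokesSolution.pressure_C2_L2 (hsol : IsRegularStokesSolution Ω T r f u₀ u p) :
    ContDiffOn ℝ 2 (fun t => (p t).toL2) (Icc 0 T) :=
  (H.toL2L (Ω := Ω) (m := 1)).contDiff.comp_contDiffOn hsol.pressure_C2_H1

/-- Boundedness of `Ω` makes its measure finite, so `L²` functions are integrable and their
integrals subtract. -/
theorem pressureSpace_sub (hΩ : Bornology.IsBounded (Ω : Set (EuclideanSpace ℝ (Fin d))))
    {q s : L2 Ω} (hq : q ∈ pressureSpace Ω) (hs : s ∈ pressureSpace Ω) :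
    q - s ∈ pressureSpace Ω := by
  have : IsFiniteMeasure (volume.restrict (Ω : Set (EuclideanSpace ℝ (Fin d)))) :=
    ⟨by rw [Measure.restrict_apply_univ]; exact hΩ.measure_lt_top⟩
  have hi : ∀ q : L2 Ω, Integrable q (volume.restrict (Ω : Set (EuclideanSpace ℝ (Fin d)))) :=
    fun q => (Lp.memLp q).integrable (by norm_num)
  change ∫ x in (Ω : Set (EuclideanSpace ℝ (Fin d))), (q - s : L2 Ω) x = 0
  rw [integral_congr_ae (Lp.coeFn_sub q s)]
  change ∫ x in (Ω : Set (EuclideanSpace ℝ (Fin d))), (q x - s x) = 0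
  rw [integral_sub (hi q) (hi s), show ∫ x in (Ω : Set _), q x = 0 from hq,
    show ∫ x in (Ω : Set _), s x = 0 from hs, sub_zero]

end ExactSolution

end NonstationaryStokes

namespace NonstationaryStokes

/-! ### Elementary facts on the mesh; interval `n + 1` runs from node `n` to node `n + 1`. -/

namespace TimeMesh

variable {T : ℝ} (M : TimeMesh T)

theorem step_succ (n : ℕ) : M.step (n + 1) = M.node (n + 1) - M.node n := rfl

theorem mid_succ (n : ℕ) : M.mid (n + 1) = (M.node n + M.node (n + 1)) / 2 := rfl

theorem step_succ_pos {n : ℕ} (hn : n < M.N) : 0 < M.step (n + 1) := by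
  rw [step_succ]
  linarith [M.node_lt n hn]

theorem step_succ_le_maxStep {n : ℕ} (hn : n < M.N) : M.step (n + 1) ≤ M.maxStep :=
  Finset.le_sup' M.step (Finset.mem_Icc.2 ⟨by omega, by omega⟩)

theorem maxStep_pos : 0 < M.maxStep :=
  (M.step_succ_pos (by have := M.two_le; omega : 0 < M.N)).trans_le
    (M.step_succ_le_maxStep (by have := M.two_le; omega))

theorem node_le_node {i j : ℕ} (hij : i ≤ j) (hj : j ≤ M.N) : M.node i ≤ M.node j := by
  rcases hij.eq_or_lt with h | h
  · rw [h]
  · exact (M.node_lt_node h hj).le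

theorem node_mem {n : ℕ} (hn : n ≤ M.N) : M.node n ∈ Icc 0 T := by
  constructor
  · rw [← M.node_zero]
    exact M.node_le_node (Nat.zero_le n) hn
  · exact (M.node_le_node hn le_rfl).trans_eq M.node_last

theorem sum_step : ∑ n ∈ Finset.range M.N, M.step (n + 1) = T := by
  simp only [step_succ]
  rw [Finset.sum_range_sub, M.node_zero, M.node_last, sub_zero]

theorem mid_mem_Ioc {n : ℕ} (hn : n < M.N) : M.mid (n + 1) ∈ Ioc (M.node n) (M.node (n + 1)) := by
  have := M.node_lt n hn
  rw [mid_succ]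
  constructor <;> linarith

theorem mid_mem {n : ℕ} (hn : n < M.N) : M.mid (n + 1) ∈ Icc 0 T := by
  have h := M.mid_mem_Ioc hn
  exact ⟨(M.node_mem (by omega)).1.trans h.1.le, h.2.trans (M.node_mem (by omega)).2⟩

end TimeMesh

theorem sum_Icc_one_eq_sum_range (N : ℕ) (F : ℕ → ℝ) :
    ∑ m ∈ Finset.Icc 1 N, F m = ∑ n ∈ Finset.range N, F (n + 1) := by
  induction N with
  | zero => simp
  | succ N ih => rw [Finset.sum_Icc_succ_top (by omega), ih, Finset.sum_range_succ]

/-! ### The scheme as a Crank–Nicolson method, and its stability. -/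

section Scheme

variable {d : ℕ} {Ω : Opens (EuclideanSpace ℝ (Fin d))} {T : ℝ} {M : TimeMesh T}
  {S : DiscreteSpaces Ω} {f : ℝ → L2Vec Ω} {u₀h : HVec Ω 1} {uh : ℝ → HVec Ω 1} {ph : ℝ → L2 Ω}

theorem IsPolyOn.exists_affine {B : Type*} [AddCommGroup B] [Module ℝ B] {J : Set ℝ}
    {X : Submodule ℝ B} {w : ℝ → B} (h : IsPolyOn 1 J X w) :
    ∃ a ∈ X, ∃ b ∈ X, ∀ t ∈ J, w t = a + t • b := by
  obtain ⟨W, hW, h⟩ := h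
  refine ⟨W 0, hW 0, W 1, hW 1, fun t ht => ?_⟩
  rw [h t ht, Fin.sum_univ_two]
  simp

theorem eqOn_Icc_affine {B : Type*} [NormedAddCommGroup B] [NormedSpace ℝ B] {w : ℝ → B} {a b : B}
    {s t : ℝ} (hst : s < t) (hw : ContinuousOn w (Icc s t)) (h : ∀ x ∈ Ioc s t, w x = a + x • b) :
    EqOn w (fun x => a + x • b) (Icc s t) := by
  have h' : EqOn w (fun x => a + x • b) (Ioc s t) := h
  refine h'.of_subset_closure hw ?_ Ioc_subset_Icc_self ?_
  · exact (continuous_const.add (continuous_id.smul continuous_const)).continuousOn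
  · rw [closure_Ioc hst.ne]

namespace IsDiscreteSolution

variable (hd : IsDiscreteSolution M S f u₀h uh ph)
include hd

theorem velocity_affine {n : ℕ} (hn : n < M.N) :
    ∃ a ∈ S.V, ∃ b ∈ S.V, ∀ t ∈ Icc (M.node n) (M.node (n + 1)), uh t = a + t • b := by
  obtain ⟨a, ha, b, hb, h⟩ :=
    (hd.velocity_poly (n + 1) (Finset.mem_Icc.2 ⟨by omega, by omega⟩)).exists_affine
  refine ⟨a, ha, b, hb, fun t ht => ?_⟩
  refine eqOn_Icc_affine (M.node_lt n hn) (hd.continuous_velocity.mono ?_) h ht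
  exact Icc_subset_Icc (M.node_mem (by omega)).1 (M.node_mem (by omega)).2

theorem velocity_mem {n : ℕ} (hn : n ≤ M.N) : uh (M.node n) ∈ S.V := by
  have h2 := M.two_le
  rcases hn.eq_or_lt with h | h
  · obtain ⟨k, rfl⟩ : ∃ k, n = k + 1 := ⟨n - 1, by omega⟩
    obtain ⟨a, ha, b, hb, hab⟩ := hd.velocity_affine (n := k) (by omega)
    rw [hab _ (right_mem_Icc.2 (M.node_lt k (by omega)).le)]
    exact S.V.add_mem ha (S.V.smul_mem _ hb)
  · obtain ⟨a, ha, b, hb, hab⟩ := hd.velocity_affine h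
    rw [hab _ (left_mem_Icc.2 (M.node_lt n h).le)]
    exact S.V.add_mem ha (S.V.smul_mem _ hb)

theorem pressure_affine {n : ℕ} (hn : n < M.N) :
    ∃ a ∈ S.Q, ∃ b ∈ S.Q, ∀ t ∈ Ioc (M.node n) (M.node (n + 1)), ph t = a + t • b :=
  (hd.pressure_poly (n + 1) (Finset.mem_Icc.2 ⟨by omega, by omega⟩)).exists_affine

theorem pressure_mid_mem {n : ℕ} (hn : n < M.N) : ph (M.mid (n + 1)) ∈ S.Q := by
  obtain ⟨a, ha, b, hb, hab⟩ := hd.pressure_affine hn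
  rw [hab _ (M.mid_mem_Ioc hn)]
  exact S.Q.add_mem ha (S.Q.smul_mem _ hb)

/-- The scheme is the Crank–Nicolson scheme for the nodal velocities and midpoint pressures. -/
theorem crankNicolson {n : ℕ} (hn : n < M.N) {v : HVec Ω 1} (hv : v ∈ S.V) :
    inner ℝ (uh (M.node (n + 1)) - uh (M.node n)).toL2 v.toL2
        + M.step (n + 1) / 2 * formA (uh (M.node n) + uh (M.node (n + 1))) v
        + M.step (n + 1) * formB v (ph (M.mid (n + 1)))
      = M.step (n + 1) / 2
        * (inner ℝ (f (M.node n)) v.toL2 + inner ℝ (f (M.node (n + 1))) v.toL2) := by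
  have hlt := M.node_lt n hn
  obtain ⟨a, -, b, -, hab⟩ := hd.velocity_affine hn
  obtain ⟨c, -, e, -, hce⟩ := hd.pressure_affine hn
  have hm : ∫ t in (M.node n)..(M.node (n + 1)),
      (inner ℝ (deriv uh t).toL2 v.toL2 + formA (uh t) v + formB v (ph t))
      = M.step (n + 1) / 2
        * (inner ℝ (f (M.node n)) v.toL2 + inner ℝ (f (M.node (n + 1))) v.toL2) :=
    hd.momentum (n + 1) (Finset.mem_Icc.2 ⟨by omega, by omega⟩) v hv
  rw [← hm]
  have hI : EqOn (fun t => inner ℝ (deriv uh t).toL2 v.toL2 + formA (uh t) v + formB v (ph t))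
      (fun t => (inner ℝ b.toL2 v.toL2 + formA a v + formB v c) + t * (formA b v + formB v e))
      (Ioo (M.node n) (M.node (n + 1))) := by
    intro t ht
    have h1 : deriv uh t = b := by
      have h2 : uh =ᶠ[𝓝 t] fun t => a + t • b :=
        Filter.eventuallyEq_of_mem (Icc_mem_nhds ht.1 ht.2) hab
      have h3 : HasDerivAt (fun t : ℝ => a + t • b) ((1 : ℝ) • b) t :=
        ((hasDerivAt_id t).smul_const b).const_add a
      rw [h2.deriv_eq, h3.deriv, one_smul]
    simp only
    rw [h1, hab t (Ioo_subset_Icc_self ht), hce t (Ioo_subset_Ioc_self ht), formA_add_left,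
      formA_smul_left, formB_add_right, formB_smul_right]
    ring
  -- The integrand is affine on the open interval, so its integral is the step times its midpoint
  -- value; the end points, where `uh` may have a kink, do not matter.
  rw [intervalIntegral.integral_congr_Ioo_of_le hlt.le hI, integral_affine,
    hab _ (left_mem_Icc.2 hlt.le), hab _ (right_mem_Icc.2 hlt.le), hce _ (M.mid_mem_Ioc hn),
    M.mid_succ, M.step_succ]
  simp only [formA_add_left, formA_smul_left, formB_add_right, formB_smul_right]
  have : (a + M.node (n + 1) • b - (a + M.node n • b)).toL2
      = (M.node (n + 1) - M.node n) • b.toL2 := by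
    rw [← HVec.toL2_smul]
    congr 1
    module
  rw [this, real_inner_smul_left]
  ring

theorem divergence_step {n : ℕ} (hn : n < M.N) {q : L2 Ω} (hq : q ∈ S.Q) :
    formB (uh (M.node n)) q + formB (uh (M.node (n + 1))) q = 0 := by
  have hlt := M.node_lt n hn
  obtain ⟨a, -, b, -, hab⟩ := hd.velocity_affine hn
  have hm : ∫ t in (M.node n)..(M.node (n + 1)), formB (uh t) q = 0 :=
    hd.incompressible (n + 1) (Finset.mem_Icc.2 ⟨by omega, by omega⟩) q hq
  have hI : EqOn (fun t => formB (uh t) q) (fun t => formB a q + t * formB b q)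
      (Ioo (M.node n) (M.node (n + 1))) := by
    intro t ht
    simp only
    rw [hab t (Ioo_subset_Icc_self ht), formB_add_left, formB_smul_left]
  rw [intervalIntegral.integral_congr_Ioo_of_le hlt.le hI, integral_affine] at hm
  rw [hab _ (left_mem_Icc.2 hlt.le), hab _ (right_mem_Icc.2 hlt.le)]
  simp only [formB_add_left, formB_smul_left]
  rcases mul_eq_zero.1 hm with h | h
  · linarith
  · linarith

theorem formB_velocity_eq_zero (h0 : u₀h ∈ S.Vdiv) {n : ℕ} (hn : n ≤ M.N) {q : L2 Ω}
    (hq : q ∈ S.Q) : formB (uh (M.node n)) q = 0 := by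
  induction n with
  | zero =>
    rw [M.node_zero, hd.initial]
    exact h0.2 q hq
  | succ n ih =>
    have := hd.divergence_step (n := n) (by omega) hq
    rw [ih (by omega)] at this
    linarith

end IsDiscreteSolution

/-- Stability of the Crank–Nicolson scheme for the discrete errors `E` of the velocity and `P` of
the pressure, with consistency errors `κ`. -/
theorem crankNicolson_stability {β ε : ℝ} (hβ : 0 < β) (hS : S.InfSup β)
    {E : ℕ → HVec Ω 1} {P : ℕ → L2 Ω} {κ : ℕ → L2Vec Ω}
    (hE : ∀ n ≤ M.N, E n ∈ S.Vdiv) (hP : ∀ n < M.N, P n ∈ S.Q)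
    (hκ : ∀ n < M.N, ‖κ n‖ ≤ M.step (n + 1) * ε)
    (heq : ∀ n < M.N, ∀ v ∈ S.V, inner ℝ (E (n + 1) - E n).toL2 v.toL2
      + M.step (n + 1) / 2 * formA (E n + E (n + 1)) v + M.step (n + 1) * formB v (P n)
      = inner ℝ (κ n) v.toL2) :
    ∑ n ∈ Finset.range M.N, M.step (n + 1) * ‖P n‖ ^ 2
      ≤ 3 * (2 + T) / β ^ 2 * (‖grad (E 0)‖ ^ 2 + T * ε ^ 2) := by
  -- Testing with the increment `E (n + 1) - E n` removes the pressure and turns the form `a` into a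
  -- difference of squared gradient norms. Young's inequality absorbs half of the squared increment.
  have hstep : ∀ n < M.N, ‖(E (n + 1) - E n).toL2‖ ^ 2 / M.step (n + 1) + ‖grad (E (n + 1))‖ ^ 2
      ≤ ‖grad (E n)‖ ^ 2 + M.step (n + 1) * ε ^ 2 := by
    intro n hn
    have hk := M.step_succ_pos hn
    set k := M.step (n + 1)
    have hE1 := hE (n + 1) (by omega)
    have hE0 := hE n (by omega)
    have h := heq n hn (E (n + 1) - E n) (S.V.sub_mem hE1.1 hE0.1)
    have hb : formB (E (n + 1) - E n) (P n) = 0 := by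
      rw [formB_sub_left, hE1.2 _ (hP n hn), hE0.2 _ (hP n hn), sub_zero]
    have ha : formA (E n + E (n + 1)) (E (n + 1) - E n)
        = ‖grad (E (n + 1))‖ ^ 2 - ‖grad (E n)‖ ^ 2 := by
      rw [formA_add_left, formA_sub_right, formA_sub_right, formA_self, formA_self,
        show formA (E n) (E (n + 1)) = formA (E (n + 1)) (E n) from real_inner_comm _ _]
      ring
    rw [hb, ha, real_inner_self_eq_norm_sq] at h
    set x := ‖(E (n + 1) - E n).toL2‖
    have h1 : inner ℝ (κ n) (E (n + 1) - E n).toL2 ≤ k * ε * x :=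
      (real_inner_le_norm _ _).trans (mul_le_mul_of_nonneg_right (hκ n hn) (norm_nonneg _))
    have h2 : x ^ 2 / k * k = x ^ 2 := div_mul_cancel₀ _ hk.ne'
    have h3 : k * (x ^ 2 / k + ‖grad (E (n + 1))‖ ^ 2)
        ≤ k * (‖grad (E n)‖ ^ 2 + k * ε ^ 2) := by
      nlinarith [sq_nonneg (x - k * ε)]
    exact le_of_mul_le_mul_left h3 hk
  have hsum : ∀ n ≤ M.N, ∑ j ∈ Finset.range n, ‖(E (j + 1) - E j).toL2‖ ^ 2 / M.step (j + 1)
      + ‖grad (E n)‖ ^ 2 ≤ ‖grad (E 0)‖ ^ 2 + ∑ j ∈ Finset.range n, M.step (j + 1) * ε ^ 2 := by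
    intro n
    induction n with
    | zero => simp
    | succ n ih =>
      intro hn
      have h1 := ih (by omega)
      have h2 := hstep n (by omega)
      rw [Finset.sum_range_succ, Finset.sum_range_succ]
      linarith
  set A := ‖grad (E 0)‖ ^ 2 + T * ε ^ 2 with hA
  have hpart : ∀ n ≤ M.N, ∑ j ∈ Finset.range n, M.step (j + 1) * ε ^ 2 ≤ T * ε ^ 2 := by
    intro n hn
    rw [← Finset.sum_mul]
    refine mul_le_mul_of_nonneg_right (le_of_le_of_eq ?_ M.sum_step) (sq_nonneg _)
    refine Finset.sum_le_sum_of_subset_of_nonneg (Finset.range_mono hn) fun i hi _ => ?_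
    exact (M.step_succ_pos (Finset.mem_range.1 hi)).le
  have hnonneg : ∀ n ≤ M.N,
      0 ≤ ∑ j ∈ Finset.range n, ‖(E (j + 1) - E j).toL2‖ ^ 2 / M.step (j + 1) := fun n hn =>
    Finset.sum_nonneg fun i hi => div_nonneg (sq_nonneg _)
      (M.step_succ_pos (by have := Finset.mem_range.1 hi; omega)).le
  have hgradA : ∀ n ≤ M.N, ‖grad (E n)‖ ^ 2 ≤ A := fun n hn => by
    have := hsum n hn
    have := hpart n hn
    have := hnonneg n hn
    linarith
  have hpress : ∀ n < M.N, M.step (n + 1) * ‖P n‖ ^ 2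
      ≤ 3 / β ^ 2 * (‖(E (n + 1) - E n).toL2‖ ^ 2 / M.step (n + 1)
        + M.step (n + 1) * (A + ε ^ 2)) := by
    intro n hn
    have hk := M.step_succ_pos hn
    set k := M.step (n + 1)
    set x := ‖(E (n + 1) - E n).toL2‖
    set y := (‖grad (E n)‖ + ‖grad (E (n + 1))‖) / 2 with hydef
    have hε : 0 ≤ k * ε := (norm_nonneg _).trans (hκ n hn)
    have hy : y ^ 2 ≤ A := by
      have h1 := hgradA n (by omega)
      have h2 := hgradA (n + 1) (by omega)
      rw [hydef]
      nlinarith [sq_nonneg (‖grad (E n)‖ - ‖grad (E (n + 1))‖)]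
    -- The inf-sup condition is applied to the pressure multiplied by the step, with the error
    -- equation solved for its pressure term.
    have hb : β * ‖k • P n‖ ≤ x + k * y + k * ε := by
      refine hS.mul_norm_le (S.Q.smul_mem _ (hP n hn)) (by positivity) fun v hv => ?_
      have h := heq n hn v hv
      rw [formB_smul_right]
      have h1 : inner ℝ (κ n) v.toL2 ≤ k * ε * ‖v.toL2‖ :=
        (real_inner_le_norm _ _).trans (mul_le_mul_of_nonneg_right (hκ n hn) (norm_nonneg _))
      have h2 := (abs_le.1 (abs_real_inner_le_norm (E (n + 1) - E n).toL2 v.toL2)).1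
      have h3 := (abs_le.1 (abs_formA_le (E n + E (n + 1)) v)).1
      have h4 : ‖grad (E n + E (n + 1))‖ ≤ 2 * y := by
        rw [grad_add]
        exact (norm_add_le _ _).trans (le_of_eq (by ring))
      have h5 : ‖grad (E n + E (n + 1))‖ * ‖grad v‖ ≤ 2 * y * ‖v‖ :=
        mul_le_mul h4 (norm_grad_le v) (norm_nonneg _) (by positivity)
      have h6 : x * ‖v.toL2‖ ≤ x * ‖v‖ :=
        mul_le_mul_of_nonneg_left (HVec.norm_toL2_le v) (norm_nonneg _)
      have h7 : k * ε * ‖v.toL2‖ ≤ k * ε * ‖v‖ :=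
        mul_le_mul_of_nonneg_left (HVec.norm_toL2_le v) hε
      have h8 : -(2 * y * ‖v‖) ≤ formA (E n + E (n + 1)) v := by linarith
      have h9 := mul_le_mul_of_nonneg_left h8 (by positivity : 0 ≤ k / 2)
      nlinarith
    rw [norm_smul, Real.norm_of_nonneg hk.le] at hb
    have hsq : (β * (k * ‖P n‖)) ^ 2 ≤ 3 * (x ^ 2 + k ^ 2 * A + k ^ 2 * ε ^ 2) := by
      have h1 : (β * (k * ‖P n‖)) ^ 2 ≤ (x + k * y + k * ε) ^ 2 :=
        pow_le_pow_left₀ (by positivity) hb 2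
      have h2 : k ^ 2 * y ^ 2 ≤ k ^ 2 * A := mul_le_mul_of_nonneg_left hy (sq_nonneg _)
      nlinarith [sq_nonneg (x - k * y), sq_nonneg (x - k * ε), sq_nonneg (k * y - k * ε)]
    have h2 : x ^ 2 / k * k = x ^ 2 := div_mul_cancel₀ _ hk.ne'
    have h3 : (k * β ^ 2) * (k * ‖P n‖ ^ 2) ≤ (k * β ^ 2) *
        (3 / β ^ 2 * (x ^ 2 / k + k * (A + ε ^ 2))) := by
      have e : (k * β ^ 2) * (3 / β ^ 2 * (x ^ 2 / k + k * (A + ε ^ 2)))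
          = 3 * (x ^ 2 / k * k + k ^ 2 * (A + ε ^ 2)) := by
        field_simp
      rw [e, h2]
      nlinarith
    exact le_of_mul_le_mul_left h3 (by positivity)
  calc ∑ n ∈ Finset.range M.N, M.step (n + 1) * ‖P n‖ ^ 2
      ≤ ∑ n ∈ Finset.range M.N, 3 / β ^ 2 * (‖(E (n + 1) - E n).toL2‖ ^ 2 / M.step (n + 1)
        + M.step (n + 1) * (A + ε ^ 2)) :=
        Finset.sum_le_sum fun n hn => hpress n (Finset.mem_range.1 hn)
    _ = 3 / β ^ 2 * (∑ n ∈ Finset.range M.N, ‖(E (n + 1) - E n).toL2‖ ^ 2 / M.step (n + 1)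
        + T * (A + ε ^ 2)) := by
        rw [← Finset.mul_sum, Finset.sum_add_distrib, ← Finset.sum_mul, M.sum_step]
    _ ≤ 3 / β ^ 2 * ((2 + T) * A) := by
        -- The increments sum to at most `A`, and `T * A` and `T * ε ^ 2 ≤ A` account for the rest,
        -- whence `2 + T`.
        refine mul_le_mul_of_nonneg_left ?_ (by positivity)
        have h1 := hsum M.N le_rfl
        have h2 := hpart M.N le_rfl
        have h3 := sq_nonneg ‖grad (E M.N)‖
        have h4 := sq_nonneg ‖grad (E 0)‖
        linarith
    _ = 3 * (2 + T) / β ^ 2 * A := by ring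

end Scheme

end NonstationaryStokes

namespace NonstationaryStokes

/-! ### Consistency and the pressure error at the midpoints. -/

section Pressure

variable {d : ℕ} {Ω : Opens (EuclideanSpace ℝ (Fin d))} {T : ℝ} {r : ℕ}
  {f : ℝ → L2Vec Ω} {u₀ : L2Vec Ω} {u : ℝ → HVec Ω 2} {p : ℝ → H Ω 1}

/-- The error equation of the scheme. -/
theorem IsDiscreteSolution.error_equation (hsol : IsRegularStokesSolution Ω T r f u₀ u p)
    (hT : 0 < T) {M : TimeMesh T} {S : DiscreteSpaces Ω} {u₀h : HVec Ω 1} {uh : ℝ → HVec Ω 1}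
    {ph : ℝ → L2 Ω} (hd : IsDiscreteSolution M S f u₀h uh ph) {R : ℝ → HVec Ω 1 × L2 Ω}
    (hR : ∀ t, S.IsStokesProjection ((u t).lower one_le_two) (p t).toL2 (R t))
    {n : ℕ} (hn : n < M.N) {v : HVec Ω 1} (hv : v ∈ S.V) :
    inner ℝ (((R (M.node (n + 1))).1 - uh (M.node (n + 1)))
          - ((R (M.node n)).1 - uh (M.node n))).toL2 v.toL2
        + M.step (n + 1) / 2 * formA (((R (M.node n)).1 - uh (M.node n))
          + ((R (M.node (n + 1))).1 - uh (M.node (n + 1)))) v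
        + M.step (n + 1) * formB v ((1 / 2 : ℝ) • ((R (M.node n)).2 + (R (M.node (n + 1))).2)
          - ph (M.mid (n + 1)))
      = inner ℝ (((R (M.node (n + 1))).1 - (R (M.node n)).1).toL2
          - (M.step (n + 1) / 2) • (derivWithin (fun s => (u s).toL2) (Icc 0 T) (M.node n)
            + derivWithin (fun s => (u s).toL2) (Icc 0 T) (M.node (n + 1)))) v.toL2 := by
  have h1 := hd.crankNicolson hn hv
  have h2 := hsol.weak_momentum hT (S.V_le hv) (M.node_mem hn.le)
  have h3 := hsol.weak_momentum hT (S.V_le hv) (M.node_mem (Nat.succ_le_of_lt hn))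
  have h4 := (hR (M.node n)).2.2.1 v hv
  have h5 := (hR (M.node (n + 1))).2.2.1 v hv
  simp only [HVec.toL2_sub, inner_sub_left, inner_add_left, real_inner_smul_left, formA_add_left,
    formA_sub_left, formB_sub_right, formB_smul_right, formB_add_right] at h1 ⊢
  -- The exact momentum equation and the Stokes projection are both used at the two nodes with
  -- weight half a step; the values of `f` then cancel against the trapezoidal rule of the scheme.
  linear_combination -h1 + (M.step (n + 1) / 2) * (h2 + h3 + h4 + h5)

/-- The consistency error of the scheme for the Stokes projection of the solution. -/
theorem IsRegularStokesSolution.exists_consistency_bound (hd : 0 < d)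
    (hΩ : Bornology.IsBounded (Ω : Set (EuclideanSpace ℝ (Fin d)))) (hT : 0 < T)
    (hsol : IsRegularStokesSolution Ω T r f u₀ u p) {β CA : ℝ} (hβ : 0 < β) (hCA : 0 < CA) :
    ∃ K : ℝ, 0 < K ∧ ∀ (S : DiscreteSpaces Ω) (h : ℝ), 0 < h → S.InfSup β →
      S.Approximates r h CA → ∀ R : ℝ → HVec Ω 1 × L2 Ω,
      (∀ t, S.IsStokesProjection ((u t).lower one_le_two) (p t).toL2 (R t)) →
      (∀ t ∈ Icc 0 T, ‖(p t).toL2 - (R t).2‖ ≤ K * h ^ r) ∧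
      ∀ s ∈ Icc 0 T, ∀ t ∈ Icc 0 T, s ≤ t →
        ‖((R t).1 - (R s).1).toL2 - ((t - s) / 2) •
          (derivWithin (fun s => (u s).toL2) (Icc 0 T) s
            + derivWithin (fun s => (u s).toL2) (Icc 0 T) t)‖
          ≤ (t - s) * (K * (h ^ r + (t - s) ^ 2)) := by
  obtain ⟨KP, hKP, hP⟩ := exists_poincare hd hΩ
  obtain ⟨KR, hKR, hRe⟩ := DiscreteSpaces.exists_stokesProjection_error d Ω r hβ hCA
  obtain ⟨U, hU, hUu⟩ := hsol.velocity_C1_Hr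
  obtain ⟨P, hPr, hPp⟩ := hsol.pressure_C1_Hr
  obtain ⟨LU, hLU, hULip⟩ := exists_lipschitz_bound hU
  obtain ⟨LP, hLP, hPLip⟩ := exists_lipschitz_bound hPr
  obtain ⟨BU, hBU, hUB⟩ := exists_norm_bound hU.continuousOn
  obtain ⟨BP, hBP, hPB⟩ := exists_norm_bound hPr.continuousOn
  obtain ⟨KT, hKT, htrap⟩ := exists_trapezoid_bound hT hsol.velocity_C3_L2
  have hlow : ∀ t ∈ Icc 0 T, (U t).lower (Nat.le_add_left 1 r) = (u t).lower one_le_two :=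
    fun t ht => HVec.ext_toL2 (hUu t ht)
  -- The summands stand for the projection error of the pressure, the projection error of velocity
  -- increments (passed to `L²` by Poincaré) and the trapezoidal error.
  refine ⟨KR * (BU + BP) + KP * KR * (LU + LP) + KT, by positivity, ?_⟩
  intro S h hh hS happ R hR
  have hhr : 0 < h ^ r := by positivity
  constructor
  · intro t ht
    have h1 := hR t
    rw [← hlow t ht, ← hPp t ht] at h1
    have h2 := (hRe S h hh hS happ (U t) (P t) (R t) (by rw [hlow t ht]; exact hsol.boundary t ht)
      (by rw [hPp t ht]; exact hsol.mean_zero t ht)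
      (by rw [hlow t ht]; exact hsol.div_eq_zero hT ht) h1).2
    rw [hPp t ht] at h2
    refine h2.trans ?_
    have h3 : KR * h ^ r * (‖U t‖ + ‖P t‖) ≤ KR * h ^ r * (BU + BP) :=
      mul_le_mul_of_nonneg_left (add_le_add (hUB t ht) (hPB t ht)) (by positivity)
    have h4 : 0 ≤ (KP * KR * (LU + LP) + KT) * h ^ r := by positivity
    linarith
  · intro s hs t ht hst
    have hts : |t - s| = t - s := abs_of_nonneg (by linarith)
    have hts0 : 0 ≤ t - s := by linarith
    have hlow' : (U t - U s).lower (Nat.le_add_left 1 r)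
        = (u t).lower one_le_two - (u s).lower one_le_two := by
      rw [HVec.lower_sub, hlow t ht, hlow s hs]
    have hPp' : (P t - P s).toL2 = (p t).toL2 - (p s).toL2 := by
      rw [H.toL2_sub, hPp t ht, hPp s hs]
    have hproj := (hR t).sub (hR s)
    have hVmem : (u t).lower one_le_two - (u s).lower one_le_two ∈ velocitySpace Ω :=
      velocitySpace_sub (hsol.boundary t ht) (hsol.boundary s hs)
    have h1 := (hRe S h hh hS happ (U t - U s) (P t - P s) (R t - R s)
      (by rw [hlow']; exact hVmem)
      (by rw [hPp']; exact pressureSpace_sub hΩ (hsol.mean_zero t ht) (hsol.mean_zero s hs))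
      (by rw [hlow', div_sub, hsol.div_eq_zero hT ht, hsol.div_eq_zero hT hs, sub_zero])
      (by rw [hlow', hPp']; exact hproj)).1
    rw [hlow'] at h1
    have h2 := hP _ (velocitySpace_sub hVmem (S.V_le hproj.1))
    have h3 : ‖U t - U s‖ + ‖P t - P s‖ ≤ (LU + LP) * (t - s) := by
      have a1 := hULip s hs t ht
      have a2 := hPLip s hs t ht
      rw [hts] at a1 a2
      linarith
    have h4 : ‖((u t).lower one_le_two - (u s).lower one_le_two - (R t - R s).1).toL2‖
        ≤ KP * (KR * h ^ r * ((LU + LP) * (t - s))) := by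
      refine h2.trans (mul_le_mul_of_nonneg_left (h1.trans ?_) hKP.le)
      exact mul_le_mul_of_nonneg_left h3 (by positivity)
    have h5 := htrap s hs t ht hst
    have e : ((R t).1 - (R s).1).toL2 - ((t - s) / 2) •
          (derivWithin (fun s => (u s).toL2) (Icc 0 T) s
            + derivWithin (fun s => (u s).toL2) (Icc 0 T) t)
        = ((u t).toL2 - (u s).toL2 - ((t - s) / 2) •
          (derivWithin (fun s => (u s).toL2) (Icc 0 T) s
            + derivWithin (fun s => (u s).toL2) (Icc 0 T) t))
          - ((u t).lower one_le_two - (u s).lower one_le_two - (R t - R s).1).toL2 := by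
      simp only [HVec.toL2_sub, HVec.lower_toL2, Prod.fst_sub]
      abel
    rw [e]
    refine (norm_sub_le _ _).trans ((add_le_add h5 h4).trans ?_)
    have h6 : 0 ≤ (t - s) * ((KR * (BU + BP) + KT) * h ^ r
      + (KR * (BU + BP) + KP * KR * (LU + LP)) * (t - s) ^ 2) := by positivity
    nlinarith

/-- The error of the discrete pressure at the midpoints of the time intervals. -/
theorem IsRegularStokesSolution.exists_midpoint_pressure_bound (hd : 0 < d)
    (hΩ : Bornology.IsBounded (Ω : Set (EuclideanSpace ℝ (Fin d)))) (hT : 0 < T)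
    (hsol : IsRegularStokesSolution Ω T r f u₀ u p) {β CA : ℝ} (hβ : 0 < β) (hCA : 0 < CA) :
    ∃ C : ℝ, 0 < C ∧ ∀ (h : ℝ) (S : DiscreteSpaces Ω) (M : TimeMesh T), 0 < h →
      S.InfSup β → S.Approximates r h CA →
      ∀ (u₀h : HVec Ω 1) (uh : ℝ → HVec Ω 1) (ph : ℝ → L2 Ω), u₀h ∈ S.Vdiv →
        IsDiscreteSolution M S f u₀h uh ph →
        ∑ n ∈ Finset.range M.N, M.step (n + 1) *
            ‖(p (M.mid (n + 1))).toL2 - ph (M.mid (n + 1))‖ ^ 2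
          ≤ C * (‖grad ((S.stokesProjection ((u 0).lower one_le_two) (p 0).toL2).1 - uh 0)‖ ^ 2
              + M.maxStep ^ 4 + h ^ (2 * r)) := by
  obtain ⟨KP, hKP, hP⟩ := exists_poincare hd hΩ
  obtain ⟨K, hK, hcons⟩ := hsol.exists_consistency_bound hd hΩ hT hβ hCA
  obtain ⟨Kp, hKp, hTay⟩ := exists_taylor_bound hT hsol.pressure_C2_L2
  set c := 3 * (2 + T) / β ^ 2 with hc
  have hc0 : 0 < c := by positivity
  refine ⟨3 * T * (Kp ^ 2 + K ^ 2) + 3 * c * (1 + 2 * T * K ^ 2), by positivity, ?_⟩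
  intro h S M hh hS happ u₀h uh ph hu₀ hdisc
  set R : ℝ → HVec Ω 1 × L2 Ω :=
    fun t => S.stokesProjection ((u t).lower one_le_two) (p t).toL2 with hRdef
  have hR : ∀ t, S.IsStokesProjection ((u t).lower one_le_two) (p t).toL2 (R t) := fun t =>
    DiscreteSpaces.isStokesProjection_stokesProjection hβ hS hP _ _
  obtain ⟨hRp, hRc⟩ := hcons S h hh hS happ R hR
  set τ := M.maxStep with hτ
  set E : ℕ → HVec Ω 1 := fun n => (R (M.node n)).1 - uh (M.node n) with hE
  -- The reference value is the average of the nodal projections rather than the projection at the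
  -- midpoint, because this average is what occurs when the two nodal equations are added.
  set χ : ℕ → L2 Ω := fun n =>
    (1 / 2 : ℝ) • ((R (M.node n)).2 + (R (M.node (n + 1))).2) - ph (M.mid (n + 1)) with hχ
  have hstab := crankNicolson_stability (M := M) (E := E) (P := χ) (ε := K * (h ^ r + τ ^ 2)) hβ hS
    (κ := fun n => ((R (M.node (n + 1))).1 - (R (M.node n)).1).toL2
      - (M.step (n + 1) / 2) • (derivWithin (fun s => (u s).toL2) (Icc 0 T) (M.node n)
        + derivWithin (fun s => (u s).toL2) (Icc 0 T) (M.node (n + 1))))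
    (fun n hn => ⟨S.V.sub_mem (hR _).1 (hdisc.velocity_mem hn), fun q hq => by
      simp only [hE]
      rw [formB_sub_left, (hR _).2.2.2 q hq, hdisc.formB_velocity_eq_zero hu₀ hn hq, sub_zero]⟩)
    (fun n hn => S.Q.sub_mem (S.Q.smul_mem _ (S.Q.add_mem (hR _).2.1 (hR _).2.1))
      (hdisc.pressure_mid_mem hn))
    (fun n hn => by
      have hk := M.step_succ_pos hn
      have hkτ := M.step_succ_le_maxStep hn
      refine (hRc _ (M.node_mem hn.le) _ (M.node_mem (Nat.succ_le_of_lt hn))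
        (M.node_lt n hn).le).trans ?_
      rw [← M.step_succ]
      gcongr)
    (fun n hn v hv => hdisc.error_equation hsol hT hR hn hv)
  have hE0 : E 0 = (R 0).1 - uh 0 := by simp only [hE, M.node_zero]
  rw [hE0, ← hc] at hstab
  set e0 := ‖grad ((R 0).1 - uh 0)‖
  have hpt : ∀ n < M.N, ‖(p (M.mid (n + 1))).toL2 - ph (M.mid (n + 1))‖ ^ 2
      ≤ 3 * (Kp ^ 2 * τ ^ 4 + K ^ 2 * h ^ (2 * r)) + 3 * ‖χ n‖ ^ 2 := by
    intro n hn
    have hk := M.step_succ_pos hn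
    have hkτ := M.step_succ_le_maxStep hn
    have hn0 := M.node_mem hn.le
    have hn1 := M.node_mem (Nat.succ_le_of_lt hn)
    have h1 : ‖(p (M.mid (n + 1))).toL2
        - (1 / 2 : ℝ) • ((p (M.node n)).toL2 + (p (M.node (n + 1))).toL2)‖
        ≤ Kp * (M.node (n + 1) - M.node n) ^ 2 / 4 := by
      refine norm_midpoint_sub_le (g := fun t => (p t).toL2)
        (G := derivWithin (fun t => (p t).toL2) (Icc 0 T) (M.mid (n + 1))) ?_
      intro t ht
      refine hTay _ (M.mid_mem hn) t ?_
      rcases ht with rfl | rfl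
      · exact hn0
      · exact hn1
    have h1' : Kp * (M.node (n + 1) - M.node n) ^ 2 / 4 ≤ Kp * τ ^ 2 := by
      rw [← M.step_succ]
      have : Kp * M.step (n + 1) ^ 2 ≤ Kp * τ ^ 2 := by gcongr
      have : 0 ≤ Kp * M.step (n + 1) ^ 2 := by positivity
      linarith
    have h2 := hRp _ hn0
    have h3 := hRp _ hn1
    -- The three contributions are the deviation of `p` at the midpoint from its nodal average, the
    -- projection error at the nodes, and the discrete error.
    have e : (p (M.mid (n + 1))).toL2 - ph (M.mid (n + 1))
        = ((p (M.mid (n + 1))).toL2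
            - (1 / 2 : ℝ) • ((p (M.node n)).toL2 + (p (M.node (n + 1))).toL2))
          + (1 / 2 : ℝ) • (((p (M.node n)).toL2 - (R (M.node n)).2)
            + ((p (M.node (n + 1))).toL2 - (R (M.node (n + 1))).2)) + χ n := by
      simp only [hχ]
      module
    have h4 : ‖(1 / 2 : ℝ) • (((p (M.node n)).toL2 - (R (M.node n)).2)
            + ((p (M.node (n + 1))).toL2 - (R (M.node (n + 1))).2))‖ ≤ K * h ^ r := by
      rw [norm_smul, Real.norm_of_nonneg (by norm_num)]
      have := norm_add_le ((p (M.node n)).toL2 - (R (M.node n)).2)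
        ((p (M.node (n + 1))).toL2 - (R (M.node (n + 1))).2)
      linarith
    have h5 : ‖(p (M.mid (n + 1))).toL2 - ph (M.mid (n + 1))‖
        ≤ Kp * τ ^ 2 + K * h ^ r + ‖χ n‖ := by
      rw [e]
      refine (norm_add_le _ _).trans (add_le_add ((norm_add_le _ _).trans ?_) le_rfl)
      exact add_le_add (h1.trans h1') h4
    have h6 := pow_le_pow_left₀ (norm_nonneg _) h5 2
    have h7 : h ^ (2 * r) = (h ^ r) ^ 2 := by rw [mul_comm, pow_mul]
    rw [h7]
    nlinarith [sq_nonneg (Kp * τ ^ 2 - K * h ^ r), sq_nonneg (Kp * τ ^ 2 - ‖χ n‖),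
      sq_nonneg (K * h ^ r - ‖χ n‖)]
  have h7 : h ^ (2 * r) = (h ^ r) ^ 2 := by rw [mul_comm, pow_mul]
  set X := e0 ^ 2 + τ ^ 4 + h ^ (2 * r) with hX
  have hτ4 : 0 ≤ τ ^ 4 := by positivity
  have hhr : 0 ≤ h ^ (2 * r) := by positivity
  have he0 : 0 ≤ e0 ^ 2 := by positivity
  have hb1 : Kp ^ 2 * τ ^ 4 + K ^ 2 * h ^ (2 * r) ≤ (Kp ^ 2 + K ^ 2) * X := by
    have : 0 ≤ Kp ^ 2 * (e0 ^ 2 + h ^ (2 * r)) := by positivity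
    have : 0 ≤ K ^ 2 * (e0 ^ 2 + τ ^ 4) := by positivity
    rw [hX]
    linarith
  have hb2 : e0 ^ 2 + T * (K * (h ^ r + τ ^ 2)) ^ 2 ≤ (1 + 2 * T * K ^ 2) * X := by
    have h8 : (h ^ r + τ ^ 2) ^ 2 ≤ 2 * (τ ^ 4 + h ^ (2 * r)) := by
      rw [h7]
      nlinarith [sq_nonneg (h ^ r - τ ^ 2)]
    have h9 : (h ^ r + τ ^ 2) ^ 2 ≤ 2 * X := by linarith
    have h10 : T * K ^ 2 * (h ^ r + τ ^ 2) ^ 2 ≤ T * K ^ 2 * (2 * X) := by gcongr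
    have h11 : e0 ^ 2 ≤ X := by linarith
    linarith
  calc ∑ n ∈ Finset.range M.N, M.step (n + 1) *
        ‖(p (M.mid (n + 1))).toL2 - ph (M.mid (n + 1))‖ ^ 2
      ≤ ∑ n ∈ Finset.range M.N, (M.step (n + 1) *
        (3 * (Kp ^ 2 * τ ^ 4 + K ^ 2 * h ^ (2 * r))) + 3 * (M.step (n + 1) * ‖χ n‖ ^ 2)) := by
        refine Finset.sum_le_sum fun n hn => ?_
        have hn' := Finset.mem_range.1 hn
        have := mul_le_mul_of_nonneg_left (hpt n hn') (M.step_succ_pos hn').le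
        linarith
    _ = T * (3 * (Kp ^ 2 * τ ^ 4 + K ^ 2 * h ^ (2 * r)))
        + 3 * ∑ n ∈ Finset.range M.N, M.step (n + 1) * ‖χ n‖ ^ 2 := by
        rw [Finset.sum_add_distrib, ← Finset.sum_mul, ← Finset.mul_sum, M.sum_step]
    _ ≤ T * (3 * ((Kp ^ 2 + K ^ 2) * X)) + 3 * (c * ((1 + 2 * T * K ^ 2) * X)) := by
        have h12 := hstab.trans (mul_le_mul_of_nonneg_left hb2 hc0.le)
        have h13 := mul_le_mul_of_nonneg_left hb1 hT.le
        linarith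
    _ = (3 * T * (Kp ^ 2 + K ^ 2) + 3 * c * (1 + 2 * T * K ^ 2)) * X := by ring

end Pressure

end NonstationaryStokes

namespace NonstationaryStokes

/-! ### Extrapolation from the midpoints and summation over the mesh. -/

namespace TimeMesh

variable {T : ℝ} (M : TimeMesh T) {B : Type*} [NormedAddCommGroup B] [NormedSpace ℝ B]

theorem continuous_interp (k : ℕ) (q : ℝ → B) : Continuous (M.interp k q) := by
  unfold interp
  fun_prop

theorem postprocessed_eq {n : ℕ} (hn : n < M.N) (q : ℝ → B) {t : ℝ}
    (ht : t ∈ Ioc (M.node n) (M.node (n + 1))) :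
    M.postprocessed q t = M.interp (max 2 (n + 1)) q t := by
  rw [postprocessed, M.index_eq (n := n + 1) (Finset.mem_Icc.2 ⟨by omega, by omega⟩) ht]

/-- To the right of a node the trajectory coincides with one affine function, whose value at the
node is therefore the right-sided limit. -/
theorem tendsto_postprocessed {n : ℕ} (hn : n < M.N) (q : ℝ → B) :
    Tendsto (M.postprocessed q) (𝓝[>] (M.node n)) (𝓝 (M.interp (max 2 (n + 1)) q (M.node n))) := by
  have h := ((M.continuous_interp (max 2 (n + 1)) q).tendsto (M.node n)).mono_left
    (nhdsWithin_le_nhds (s := Ioi (M.node n)))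
  refine h.congr' ?_
  filter_upwards [Ioc_mem_nhdsGT (M.node_lt n hn)] with t ht
  exact (M.postprocessed_eq hn q ht).symm

/-- The error of the interpolation of perturbed midpoint values. -/
theorem norm_sub_interp_le {g : ℝ → B} {K : ℝ} (hK : 0 ≤ K)
    (hg : ∀ s ∈ Icc 0 T, ∀ t ∈ Icc 0 T,
      ‖g t - g s - (t - s) • derivWithin g (Icc 0 T) s‖ ≤ K * (t - s) ^ 2) (q : ℝ → B)
    {j : ℕ} (hj : j + 2 ≤ M.N) {t : ℝ} (ht : t ∈ Icc (M.node j) (M.node (j + 2))) :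
    ‖g t - M.interp (j + 2) q t‖ ^ 2 ≤ 1200 * K ^ 2 * M.maxStep ^ 4
      + 27 * (‖g (M.mid (j + 1)) - q (M.mid (j + 1))‖ ^ 2
        + ‖g (M.mid (j + 2)) - q (M.mid (j + 2))‖ ^ 2) := by
  have h1 := M.node_lt j (by omega)
  have h2 := M.node_lt (j + 1) (by omega)
  have s1 := M.step_succ_le_maxStep (n := j) (by omega)
  have s2 := M.step_succ_le_maxStep (n := j + 1) (by omega)
  rw [M.step_succ] at s1 s2
  have m1 := M.mid_succ j
  have m2 := M.mid_succ (j + 1)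
  simp only [add_assoc, Nat.reduceAdd] at h2 s2 m2
  have htT : t ∈ Icc 0 T := ⟨(M.node_mem (by omega)).1.trans ht.1,
    ht.2.trans (M.node_mem (by omega)).2⟩
  -- The midpoints are half of the two intervals' total length apart, so the quotient lies between
  -- `-1` and `2` for any ratio of the two steps.
  have hs : |(t - M.mid (j + 1)) / (M.mid (j + 2) - M.mid (j + 1))| ≤ 2 := by
    have hpos : 0 < M.mid (j + 2) - M.mid (j + 1) := by linarith
    rw [abs_div, abs_of_pos hpos, div_le_iff₀ hpos, abs_le]
    constructor <;> linarith [ht.1, ht.2]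
  have key := norm_sub_linear_le (g := g) (A := q (M.mid (j + 1))) (B := q (M.mid (j + 2)))
    (δ := 2 * M.maxStep) hK (by linarith : M.mid (j + 1) < M.mid (j + 2)) hs
    (by rw [abs_le]; constructor <;> linarith [ht.1, ht.2])
    (by rw [abs_le]; constructor <;> linarith [ht.1, ht.2])
    (hg t htT _ (M.mid_mem (n := j) (by omega))) (hg t htT _ (M.mid_mem (n := j + 1) (by omega)))
  have h3 := pow_le_pow_left₀ (norm_nonneg _) key 2
  refine h3.trans ?_
  set x := ‖g (M.mid (j + 1)) - q (M.mid (j + 1))‖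
  set y := ‖g (M.mid (j + 2)) - q (M.mid (j + 2))‖
  set z := K * M.maxStep ^ 2 with hz
  have e : 5 * K * (2 * M.maxStep) ^ 2 + 3 * x + 2 * y = 20 * z + 3 * x + 2 * y := by
    rw [hz]
    ring
  have e' : K ^ 2 * M.maxStep ^ 4 = z ^ 2 := by
    rw [hz]
    ring
  rw [e, mul_assoc 1200, e']
  -- By `(a + b + c)² ≤ 3 (a² + b² + c²)` the coefficients are `1200`, `27` and `12`, the last
  -- enlarged to `27`.
  nlinarith [sq_nonneg (20 * z - 3 * x), sq_nonneg (20 * z - 2 * y), sq_nonneg (3 * x - 2 * y),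
    sq_nonneg y]

/-- Summation of interpolated quantities against the step sizes of a mesh of bounded ratios. -/
theorem sum_step_mul_interp_le {c₁ c₂ : ℝ} (hc₁ : 0 < c₁) (hc₂ : 0 < c₂)
    (h₁ : M.step 1 ≤ c₁ * M.step 2)
    (h₂ : ∀ m ∈ Finset.Icc 2 M.N, M.step m ≤ c₂ * M.step (m - 1)) {e : ℕ → ℝ}
    (he : ∀ n, 0 ≤ e n) :
    ∑ n ∈ Finset.range M.N, M.step (n + 1) * (e (n - 1 + 1) + e (n - 1 + 2))
      ≤ (2 + c₁ + c₂) * ∑ n ∈ Finset.range M.N, M.step (n + 1) * e (n + 1) := by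
  obtain ⟨N, hN⟩ : ∃ N, M.N = N + 2 := ⟨M.N - 2, by have := M.two_le; omega⟩
  set s : ℕ → ℝ := fun n => M.step (n + 1) * e (n + 1) with hs
  have hs0 : ∀ n < N + 2, 0 ≤ s n := fun n hn =>
    mul_nonneg (M.step_succ_pos (by omega)).le (he _)
  rw [hN]
  set A := ∑ n ∈ Finset.range (N + 2), s n with hA
  have hle : ∀ n < N + 2, s n ≤ A := fun n hn =>
    Finset.single_le_sum (f := s) (fun i hi => hs0 i (Finset.mem_range.1 hi))
      (Finset.mem_range.2 hn)
  have hA1 : A = ∑ n ∈ Finset.range (N + 1), s (n + 1) + s 0 := Finset.sum_range_succ' _ _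
  have hA2 : A = ∑ n ∈ Finset.range (N + 1), s n + s (N + 1) := Finset.sum_range_succ _ _
  have h01 : s 0 + s 1 ≤ A := by
    rw [hA1, Finset.sum_range_succ']
    have : 0 ≤ ∑ n ∈ Finset.range N, s (n + 1 + 1) :=
      Finset.sum_nonneg fun n hn => hs0 _ (by have := Finset.mem_range.1 hn; omega)
    simp only [zero_add]
    linarith
  -- On the first interval the truncated `0 - 1` selects the midpoints of intervals 1 and 2. The
  -- second error carries the foreign weight `M.step 1`, which `c₁` converts.
  have hfirst : M.step (0 + 1) * (e (0 - 1 + 1) + e (0 - 1 + 2)) ≤ (1 + c₁) * A := by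
    have h3 : M.step 1 * e 2 ≤ c₁ * M.step 2 * e 2 := mul_le_mul_of_nonneg_right h₁ (he 2)
    have h4 : s 0 = M.step 1 * e 1 := rfl
    have h5 : s 1 = M.step 2 * e 2 := rfl
    have h6 := hle 0 (by omega)
    have h7 := mul_le_mul_of_nonneg_left (hle 1 (by omega)) hc₁.le
    simp only [zero_add, Nat.zero_sub]
    linarith
  -- On later intervals the error at the preceding midpoint carries the weight of its successor,
  -- which `c₂` converts.
  have hrest : ∑ n ∈ Finset.range (N + 1),
      M.step (n + 1 + 1) * (e (n + 1 - 1 + 1) + e (n + 1 - 1 + 2)) ≤ (1 + c₂) * A := by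
    calc _ ≤ ∑ n ∈ Finset.range (N + 1), (c₂ * s n + s (n + 1)) := by
          refine Finset.sum_le_sum fun n hn => ?_
          have hn' := Finset.mem_range.1 hn
          have h3 := h₂ (n + 2) (Finset.mem_Icc.2 ⟨by omega, by omega⟩)
          have h4 := mul_le_mul_of_nonneg_right h3 (he (n + 1))
          have h5 : s n = M.step (n + 1) * e (n + 1) := rfl
          have h6 : s (n + 1) = M.step (n + 2) * e (n + 2) := rfl
          simp only [Nat.add_sub_cancel, add_assoc, Nat.reduceAdd]
          have h7 : M.step (n + 2 - 1) = M.step (n + 1) := rfl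
          rw [h7] at h4
          linarith
      _ = c₂ * ∑ n ∈ Finset.range (N + 1), s n + ∑ n ∈ Finset.range (N + 1), s (n + 1) := by
          rw [Finset.sum_add_distrib, ← Finset.mul_sum]
      _ ≤ (1 + c₂) * A := by
          have h3 := hs0 0 (by omega)
          have h4 := hs0 (N + 1) (by omega)
          have h5 : c₂ * ∑ n ∈ Finset.range (N + 1), s n ≤ c₂ * A :=
            mul_le_mul_of_nonneg_left (by linarith) hc₂.le
          linarith
  rw [Finset.sum_range_succ']
  linarith

/-- Integration over the mesh of a function with a bound on every interval. -/
theorem intervalIntegrable_and_integral_le {F : ℝ → ℝ} {G : ℕ → ℝ}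
    (hF : ∀ n < M.N, ∃ Φ : ℝ → ℝ, ContinuousOn Φ (Icc (M.node n) (M.node (n + 1))) ∧
      ∀ t ∈ Ioc (M.node n) (M.node (n + 1)), F t = Φ t ∧ |Φ t| ≤ G n) :
    IntervalIntegrable F volume 0 T ∧
      ∫ t in (0 : ℝ)..T, F t ≤ ∑ n ∈ Finset.range M.N, M.step (n + 1) * G n := by
  have hint : ∀ n < M.N, IntervalIntegrable F volume (M.node n) (M.node (n + 1)) := by
    intro n hn
    obtain ⟨Φ, hΦ, h⟩ := hF n hn
    have hlt := M.node_lt n hn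
    refine (hΦ.intervalIntegrable_of_Icc hlt.le).congr fun t ht => ?_
    rw [uIoc_of_le hlt.le] at ht
    exact (h t ht).1.symm
  have h1 := IntervalIntegrable.trans_iterate hint
  have h2 := intervalIntegral.sum_integral_adjacent_intervals hint
  rw [M.node_zero, M.node_last] at h1 h2
  refine ⟨h1, ?_⟩
  rw [← h2]
  refine Finset.sum_le_sum fun n hn => ?_
  have hn' := Finset.mem_range.1 hn
  obtain ⟨Φ, -, h⟩ := hF n hn'
  have hlt := M.node_lt n hn'
  have h3 := intervalIntegral.norm_integral_le_of_norm_le_const (f := F) (a := M.node n)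
    (b := M.node (n + 1)) (C := G n) (fun t ht => by
      rw [uIoc_of_le hlt.le] at ht
      rw [(h t ht).1]
      exact (h t ht).2)
  rw [abs_of_pos (by linarith), ← M.step_succ] at h3
  exact (le_abs_self _).trans (h3.trans_eq (mul_comm _ _))

end TimeMesh

end NonstationaryStokes

/-! ### The two error estimates for the post-processed pressure. -/

theorem mainTheorem6 {d : ℕ} (hd : d = 2 ∨ d = 3)
    (Ω : Opens (EuclideanSpace ℝ (Fin d)))
    (hΩ_bounded : Bornology.IsBounded (Ω : Set (EuclideanSpace ℝ (Fin d))))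
    (hΩ_connected : IsConnected (Ω : Set (EuclideanSpace ℝ (Fin d))))
    (T : ℝ) (hT : 0 < T) (r : ℕ) (hr : 1 ≤ r)
    (f : ℝ → L2Vec Ω) (u₀ : L2Vec Ω) (u : ℝ → HVec Ω 2) (p : ℝ → H Ω 1)
    (hsol : IsRegularStokesSolution Ω T r f u₀ u p)
    (β CA c₁ c₂ : ℝ) (hβ : 0 < β) (hCA : 0 < CA) (hc₁ : 0 < c₁) (hc₂ : 0 < c₂) :
    ∃ C : ℝ, 0 < C ∧
      ∀ (h : ℝ) (S : DiscreteSpaces Ω) (M : TimeMesh T), 0 < h →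
        S.InfSup β → S.Approximates r h CA →
        M.step 1 ≤ c₁ * M.step 2 →
        (∀ m ∈ Finset.Icc 2 M.N, M.step m ≤ c₂ * M.step (m - 1)) →
        ∀ (u₀h : HVec Ω 1) (uh : ℝ → HVec Ω 1) (ph : ℝ → L2 Ω), u₀h ∈ S.Vdiv →
          IsDiscreteSolution M S f u₀h uh ph →
          (∀ m ∈ Finset.Icc 1 M.N,
            Tendsto (M.postprocessed ph) (𝓝[>] (M.node (m - 1)))
              (𝓝 (Function.rightLim (M.postprocessed ph) (M.node (m - 1))))) ∧
          ∑ m ∈ Finset.Icc 1 M.N, M.step m *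
              ‖(p (M.node (m - 1))).toL2
                - Function.rightLim (M.postprocessed ph) (M.node (m - 1))‖ ^ 2
            ≤ C * (‖grad ((S.stokesProjection ((u 0).lower one_le_two) (p 0).toL2).1 - uh 0)‖ ^ 2
                + M.maxStep ^ 4 + h ^ (2 * r)) ∧
          IntervalIntegrable (fun t => ‖(p t).toL2 - M.postprocessed ph t‖ ^ 2) volume 0 T ∧
          Real.sqrt (∫ t in (0 : ℝ)..T, ‖(p t).toL2 - M.postprocessed ph t‖ ^ 2)
            ≤ C * (‖grad ((S.stokesProjection ((u 0).lower one_le_two) (p 0).toL2).1 - uh 0)‖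
                + M.maxStep ^ 2 + h ^ r) := by
  obtain ⟨C₀, hC₀, hmid⟩ :=
    hsol.exists_midpoint_pressure_bound (by omega) hΩ_bounded hT hβ hCA
  obtain ⟨K, hK, hTay⟩ := exists_taylor_bound hT hsol.pressure_C2_L2
  set D := 1200 * K ^ 2 * T + 27 * ((2 + c₁ + c₂) * C₀) with hD
  have hD0 : 0 < D := by positivity
  -- One constant serves both estimates: the first needs `D ≤ D + 1`, the second, after the square
  -- root, `D ≤ (D + 1) ^ 2`.
  refine ⟨D + 1, by positivity, ?_⟩
  intro h S M hh hS happ h₁ h₂ u₀h uh ph hu₀ hdisc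
  have hsum := hmid h S M hh hS happ u₀h uh ph hu₀ hdisc
  set e0 := ‖grad ((S.stokesProjection ((u 0).lower one_le_two) (p 0).toL2).1 - uh 0)‖
  set X := e0 ^ 2 + M.maxStep ^ 4 + h ^ (2 * r) with hX
  set e : ℕ → ℝ := fun n => ‖(p (M.mid n)).toL2 - ph (M.mid n)‖ ^ 2 with he
  set G : ℕ → ℝ := fun n => 1200 * K ^ 2 * M.maxStep ^ 4
    + 27 * (e (n - 1 + 1) + e (n - 1 + 2)) with hG
  have hτ := M.maxStep_pos
  have he0 : 0 ≤ e0 := norm_nonneg _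
  have hbound : ∀ n < M.N, ∀ t ∈ Icc (M.node n) (M.node (n + 1)),
      ‖(p t).toL2 - M.interp (max 2 (n + 1)) ph t‖ ^ 2 ≤ G n := by
    intro n hn t ht
    have h2N := M.two_le
    -- The truncated subtraction gives the value `2` for both `n = 0` and `n = 1`, matching the use
    -- of `J_2` on the first two intervals.
    have hmax : max 2 (n + 1) = n - 1 + 2 := by omega
    rw [hmax]
    refine M.norm_sub_interp_le (g := fun t => (p t).toL2) hK.le hTay ph (by omega) ⟨?_, ?_⟩
    · exact (M.node_le_node (by omega) hn.le).trans ht.1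
    · exact ht.2.trans (M.node_le_node (by omega) (by omega))
  have hGsum : ∑ n ∈ Finset.range M.N, M.step (n + 1) * G n ≤ D * X := by
    have h3 := M.sum_step_mul_interp_le hc₁ hc₂ h₁ h₂ (e := e) (fun n => sq_nonneg _)
    have h4 : ∑ n ∈ Finset.range M.N, M.step (n + 1) * G n
        = T * (1200 * K ^ 2 * M.maxStep ^ 4) + 27 * ∑ n ∈ Finset.range M.N,
          M.step (n + 1) * (e (n - 1 + 1) + e (n - 1 + 2)) := by
      have h5 : ∀ n, M.step (n + 1) * G n = M.step (n + 1) * (1200 * K ^ 2 * M.maxStep ^ 4)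
          + 27 * (M.step (n + 1) * (e (n - 1 + 1) + e (n - 1 + 2))) := fun n => by
        simp only [hG]
        ring
      simp only [h5]
      rw [Finset.sum_add_distrib, ← Finset.sum_mul, ← Finset.mul_sum, M.sum_step]
    have h6 : (2 + c₁ + c₂) * ∑ n ∈ Finset.range M.N, M.step (n + 1) * e (n + 1)
        ≤ (2 + c₁ + c₂) * (C₀ * X) := mul_le_mul_of_nonneg_left hsum (by positivity)
    have h7 : T * (1200 * K ^ 2 * M.maxStep ^ 4) ≤ T * (1200 * K ^ 2 * X) := by
      have : M.maxStep ^ 4 ≤ X := by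
        have : 0 ≤ h ^ (2 * r) := by positivity
        have : 0 ≤ e0 ^ 2 := by positivity
        linarith
      gcongr
    rw [h4, hD]
    linarith
  have hright : ∀ n < M.N, Function.rightLim (M.postprocessed ph) (M.node n)
      = M.interp (max 2 (n + 1)) ph (M.node n) := fun n hn =>
    rightLim_eq_of_tendsto (M.tendsto_postprocessed hn ph)
  have hX0 : 0 ≤ X := by positivity
  have hint := M.intervalIntegrable_and_integral_le (G := G)
    (F := fun t => ‖(p t).toL2 - M.postprocessed ph t‖ ^ 2) (fun n hn => by
      refine ⟨fun t => ‖(p t).toL2 - M.interp (max 2 (n + 1)) ph t‖ ^ 2, ?_, fun t ht => ⟨?_, ?_⟩⟩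
      · refine ((ContinuousOn.sub ?_ (M.continuous_interp _ ph).continuousOn).norm).pow 2
        exact hsol.pressure_C2_L2.continuousOn.mono
          (Icc_subset_Icc (M.node_mem hn.le).1 (M.node_mem (Nat.succ_le_of_lt hn)).2)
      · simp only [M.postprocessed_eq hn ph ht]
      · rw [abs_of_nonneg (by positivity)]
        exact hbound n hn t (Ioc_subset_Icc_self ht))
  refine ⟨fun m hm => ?_, ?_, hint.1, ?_⟩
  · obtain ⟨n, rfl⟩ : ∃ n, m = n + 1 := ⟨m - 1, by have := (Finset.mem_Icc.1 hm).1; omega⟩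
    have hn : n < M.N := by have := (Finset.mem_Icc.1 hm).2; omega
    rw [Nat.add_sub_cancel, hright n hn]
    exact M.tendsto_postprocessed hn ph
  · rw [sum_Icc_one_eq_sum_range]
    refine (Finset.sum_le_sum fun n hn => ?_).trans (hGsum.trans (by linarith))
    have hn' := Finset.mem_range.1 hn
    rw [Nat.add_sub_cancel, hright n hn']
    -- The right-sided limit is the interpolant at the left end point, which the bound on the closed
    -- interval includes.
    exact mul_le_mul_of_nonneg_left
      (hbound n hn' _ (left_mem_Icc.2 (M.node_lt n hn').le)) (M.step_succ_pos hn').le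
  · set Y := e0 + M.maxStep ^ 2 + h ^ r with hY
    have hY0 : 0 ≤ Y := by positivity
    have hXY : X ≤ Y ^ 2 := by
      have h3 : h ^ (2 * r) = (h ^ r) ^ 2 := by rw [mul_comm, pow_mul]
      have h4 : 0 ≤ h ^ r := by positivity
      have h5 : 0 ≤ M.maxStep ^ 2 := by positivity
      have h6 := mul_nonneg he0 h5
      have h7 := mul_nonneg he0 h4
      have h8 := mul_nonneg h5 h4
      rw [hX, hY, h3]
      linarith
    refine Real.sqrt_le_iff.2 ⟨by positivity, (hint.2.trans hGsum).trans ?_⟩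
    have h3 : D * X ≤ D * Y ^ 2 := mul_le_mul_of_nonneg_left hXY hD0.le
    have h4 : D ≤ (D + 1) ^ 2 := by nlinarith
    have h5 := mul_le_mul_of_nonneg_right h4 (sq_nonneg Y)
    rw [mul_pow]
    linarith
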